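/- For $a,b\in\mathbb R$ let $\Lambda_{a,b}(x,y)=(-a|x|-by+(a-b-1),\,x)$ be the Lozi map; for $b=0$ it reduces to the tent family. For a sign $\sigma\in S=\{-1,+1\}$ let $\Lambda_\sigma(x,y)=(-\sigma a x-by+(a-b-1),\,x)$ be its affine branches, and for a finite itinerary $I=(I_1,\dots,I_N)\in S^N$ let $\Lambda_I=\Lambda_{I_N}\circ\cdots\circ\Lambda_{I_1}$. A point $\theta\in\mathbb R^2$ is a formal $I$-periodic point if $\Lambda_I(\theta)=\theta$. It is $I$-admissible if $I_{k+1}\,\pi_1(\Lambda_{(I_1,\dots,I_k)}(\theta))\ge 0$ for $0\le k<N$, where $\pi_1(x,y)=x$; then $\Lambda_{(I_1,\dots,I_k)}(\theta)=\Lambda_{a,b}^k(\theta)$ for $0\le k\le N$. For $m,n\ge 2$ let $$\iota_{\sigma,m,n}=(+\,\underbrace{-\cdots-}_{m-2}\,+\,+\,\underbrace{-\cdots-}_{n-2}\,\sigma),$$ an itinerary of length $m+n$. Where the formal $\iota_{\sigma,m,n}$-periodic point at $(a,b)$ is unique, denote it by $\theta_{\sigma,m,n}$. A border collision occurs for $\theta_{\sigma,m,n}$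 at $(a,b)$ if $\theta_{\sigma,m,n}$ is $\iota_{\sigma,m,n}$-admissible and $\pi_1(\Lambda_{a,b}^k(\theta_{\sigma,m,n}))=0$ for some $0\le k<m+n$. The parameter $(a,b)$ is an $\iota_{\pm,m,n}$-bifurcation parameter if $\theta_{-,m,n}=\theta_{+,m,n}$, this point is both $\iota_{-,m,n}$- and $\iota_{+,m,n}$-admissible, and $\pi_1(\Lambda_{a,b}^{m+n-1}(\theta_{\pm,m,n}))=0$. For $\bar b\in(0,1)$ let $P(\bar b)=\{(a,b): a>3b+1,\ 0\le b\le\bar b\}$. **Theorem.** For every $\hat b\in(0,1)$ there are $\bar b\in(0,\hat b)$, an integer $m\ge 5$, and two functions $l_{m,2},l_{m,3}:[0,\bar b]\to(\sqrt2,4)$, real analytic on (a neighborhood of) $[0,\bar b]$, with $(l_{m,n}(b),b)\in P(\bar b)$ for all $b\in[0,\bar b]$ and $n\in\{2,3\}$, such that the following hold. 1. For all $(a,b)\in P(\bar b)$, $\sigma\in S$ and $n\in\{2,3\}$, there is exactly one formal $\iota_{\sigma,m,n}$-periodic point $\theta_{\sigma,m,n}$ at $(a,b)$. It is $\iota_{\sigma,m,n}$-admissible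 if and only if $a\ge l_{m,n}(b)$. A border collision occurs for $\theta_{\sigma,m,n}$ at $(a,b)$ if and only if $a=l_{m,n}(b)$, and $(a,b)$ is an $\iota_{\pm,m,n}$-bifurcation parameter if and only if $a=l_{m,n}(b)$. 2. $l_{m,2}(0)<l_{m,3}(0)$ and $l_{m,2}(\bar b)>l_{m,3}(\bar b)$. 3. There is exactly one $b\in[0,\bar b]$ with $l_{m,2}(b)=l_{m,3}(b)$, and the curves $a=l_{m,2}(b)$ and $a=l_{m,3}(b)$ cross transversally there, that is, $l_{m,2}'(b)\ne l_{m,3}'(b)$. 4. Consequently the order of creation of the orbits reverses. On the line $b=0$, for all $a>1$ and $\sigma,\tau\in S$, if $\theta_{\sigma,m,3}$ is admissible at $(a,0)$ then $\theta_{\tau,m,2}$ is admissible at $(a,0)$. On the line $b=\bar b$ this forcing fails: for some $a$ with $(a,\bar b)\in P(\bar b)$, both points $\theta_{\pm,m,3}$ are admissible at $(a,\bar b)$ and neither of the points $\theta_{\pm,m,2}$ is. -/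

import Mathlib

namespace Lozi

/-- The Lozi map `Λ_{a,b}(x, y) = (-a|x| - b y + (a - b - 1), x)`. -/
def lozi (a b : ℝ) (p : ℝ × ℝ) : ℝ × ℝ :=
  (-a * |p.1| - b * p.2 + (a - b - 1), p.1)

/-- The affine branch `Λ_σ(x, y) = (-σ a x - b y + (a - b - 1), x)`, for a sign `σ`.
The alphabet `S = {-1, +1}` is the group of units of `ℤ`. -/
def branch (a b : ℝ) (σ : ℤˣ) (p : ℝ × ℝ) : ℝ × ℝ :=
  (-((σ : ℤ) : ℝ) * a * p.1 - b * p.2 + (a - b - 1), p.1)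

/-- `Λ_I = Λ_{I_N} ∘ ⋯ ∘ Λ_{I_1}` for a finite itinerary `I = (I_1, …, I_N)`. -/
def formalIterate (a b : ℝ) (I : List ℤˣ) (p : ℝ × ℝ) : ℝ × ℝ :=
  I.foldl (fun q σ => branch a b σ q) p

/-- `θ` is a formal `I`-periodic point at the parameter `(a, b)`. -/
def IsFormalPeriodic (a b : ℝ) (I : List ℤˣ) (θ : ℝ × ℝ) : Prop :=
  formalIterate a b I θ = θ

/-- `θ` is `I`-admissible: for every `k < l(I)`, the first coordinate of the `k`-th point
`Λ_{(I_1, …, I_k)}(θ)` of the formal orbit lies in `I_{k+1} · [0, ∞)`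
(indices of lists start at `0`). -/
def IsAdmissible (a b : ℝ) (I : List ℤˣ) (θ : ℝ × ℝ) : Prop :=
  ∀ (k : ℕ) (hk : k < I.length),
    0 ≤ (((I[k] : ℤˣ) : ℤ) : ℝ) * (formalIterate a b (I.take k) θ).1

/-- Along an admissible point the formal orbit is the orbit of the Lozi map. -/
theorem IsAdmissible.formalIterate_take_eq {a b : ℝ} {I : List ℤˣ} {θ : ℝ × ℝ}
    (h : IsAdmissible a b I θ) :
    ∀ k ≤ I.length, formalIterate a b (I.take k) θ = (lozi a b)^[k] θ := by
  intro k
  induction k with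
  | zero => intro _; simp [formalIterate]
  | succ k ih =>
    intro hk
    have h1 := h k hk
    have h2 := ih (Nat.le_of_succ_le hk)
    rw [h2] at h1
    rw [Function.iterate_succ_apply']
    have h3 : formalIterate a b (I.take (k + 1)) θ
        = branch a b I[k] (formalIterate a b (I.take k) θ) := by
      have h5 : I.take (k + 1) = I.take k ++ [I[k]] := by simp
      unfold formalIterate
      rw [h5, List.foldl_append]
      rfl
    rw [h3, h2]
    rcases Int.units_eq_one_or I[k] with hs | hs
    · rw [hs] at h1 ⊢
      have h4 : 0 ≤ ((lozi a b)^[k] θ).1 := by simpa using h1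
      simp [branch, lozi, abs_of_nonneg h4]
    · rw [hs] at h1 ⊢
      have h4 : ((lozi a b)^[k] θ).1 ≤ 0 := by simpa using h1
      simp [branch, lozi, abs_of_nonpos h4]

/-- The itinerary `ι_{σ,m,n} = (+ (-)^{m-2} + + (-)^{n-2} σ)` of length `m + n`, for
`m, n ≥ 2`. -/
def iota (σ : ℤˣ) (m n : ℕ) : List ℤˣ :=
  [1] ++ List.replicate (m - 2) (-1) ++ [1, 1] ++ List.replicate (n - 2) (-1) ++ [σ]

/-- The formal `ι_{σ,m,n}`-periodic point is admissible at `(a, b)`. -/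
def AdmissibleAt (a b : ℝ) (σ : ℤˣ) (m n : ℕ) : Prop :=
  ∃ θ : ℝ × ℝ, IsFormalPeriodic a b (iota σ m n) θ ∧ IsAdmissible a b (iota σ m n) θ

/-- The orbit of the formal `I`-periodic point collides with the border `x = 0` at `(a, b)`:
the point is admissible and some point of its orbit lies on the line `x = 0`. -/
def BorderCollisionAt (a b : ℝ) (I : List ℤˣ) : Prop :=
  ∃ θ : ℝ × ℝ, IsFormalPeriodic a b I θ ∧ IsAdmissible a b I θ ∧
    ∃ k < I.length, ((lozi a b)^[k] θ).1 = 0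

/-- `(a, b)` is an `ι_{±,m,n}`-bifurcation parameter: the formal `ι_{-,m,n}`- and
`ι_{+,m,n}`-periodic points are admissible and coincide, and the orbit is on the line `x = 0`
at the place of the one symbol in which the two itineraries differ. -/
def BifurcationParameter (a b : ℝ) (m n : ℕ) : Prop :=
  ∃ θ : ℝ × ℝ,
    (∀ σ : ℤˣ, IsFormalPeriodic a b (iota σ m n) θ ∧ IsAdmissible a b (iota σ m n) θ) ∧
    ((lozi a b)^[m + n - 1] θ).1 = 0

/-- The neighborhood `{(a, b) ; a > 3 b + 1, 0 ≤ b ≤ b₁}` of the tent family, for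
`b₁ < 1`. -/
def Pnbd (b₁ : ℝ) : Set (ℝ × ℝ) :=
  {p | 3 * p.2 + 1 < p.1 ∧ 0 ≤ p.2 ∧ p.2 ≤ b₁}

end Lozi

open Lozi

/-!
Write `u_k = x_k + 1` for the first coordinates of a formal periodic orbit, so that the fixed point
`x = -1` of the branch with negative sign becomes `u = 0`.  The orbit is a cyclic sequence with
`u_{k+1} = a - s_k a (u_k - 1) - b u_{k-1}`.  Solving for the middle term gives a contraction in
the supremum norm as soon as `a > 1 + |b|` (`cyclic_le`).  This yields existence and uniqueness of
the periodic point, the bound `|x| ≤ 1` for `b ≥ 0`, and Lipschitz dependence on the parameter,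
all independently of the length of the itinerary.

The parameters with `0 ≤ b` small fall into three ranges.  For `a > 2 + 2 b` every itinerary is
strictly admissible (`IsCyclicOrbit.sign_mul_pos`).  For `a < 2 - 1/50` no orbit with one of the
given itineraries is admissible: after its lowest point it would rise above the border too early
(`IsCyclicOrbit.not_admissible`).  In the window around `a = 2` the orbit is nearly explicit.  If
`m` is large, the `m - 2` negative symbols force `u` to be of order `b` after the visit to the maximum, so
`u_0` is close to `2`, and the terms before the last place are close to constants: the term `w`
before the last place is close to `3/2` for `n = 2` and to `1/2` for `n = 3`.  All admissibility
conditions but the last one hold strictly there.  The last one is `t ≥ 0` for the height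
`t = σ x_{-1}`, and to first order `2 dt = da - (w - 1) db`
(`IsWindowOrbit.abs_height_diff_le`).

Hence `t` increases with `a` and has a unique zero `a = l_{m,n}(b)`, which is analytic in `b` by the
implicit function theorem, as the periodic point is a rational function of `(a, b)`.  The zero does
not depend on `σ`, because on the border the two branches agree.  The expansion of `t` also
shows that `l_{m,2}` has slope close to `1/2` and `l_{m,3}` slope close to `-1/2`.  On `b = 0` an
explicit computation gives `l_{m,2}(0) < l_{m,3}(0)` (`borderCurve_two_zero_lt`), with both values
exponentially close to `2` in `m`.  So for fixed `bbar` and `m` large the two curves cross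
exactly once, transversally, before `b = bbar`.
-/

namespace Lozi

open scoped Topology ContDiff

/-! ### Cyclic sequences -/

/-- Maximum principle for cyclic sequences: when the middle term of three neighbours is
expanded by a factor `a > 1 + β`, the sequence is bounded by the forcing term. -/
theorem cyclic_le {N : ℕ} (hN : 0 < N) {y : ℕ → ℝ} (h0 : y N = y 0) (h1 : y (N + 1) = y 1)
    {a β C : ℝ} (hβ : 0 ≤ β) (hab : 1 + β < a)
    (h : ∀ k < N, a * y (k + 1) ≤ y (k + 2) + β * y k + C) :
    ∀ k ≤ N + 1, y k ≤ C / (a - 1 - β) := by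
  obtain ⟨j, hj, hmax⟩ := Finset.exists_max_image (Finset.range N) (fun k => y (k + 1))
    ⟨0, Finset.mem_range.2 hN⟩
  have hall : ∀ k ≤ N + 1, y k ≤ y (j + 1) := by
    intro k hk
    rcases Nat.eq_zero_or_pos k with rfl | hk0
    · have := hmax (N - 1) (Finset.mem_range.2 (by omega))
      rwa [show N - 1 + 1 = N by omega, h0] at this
    · rcases Nat.lt_or_ge N k with hk1 | hk1
      · obtain rfl : k = N + 1 := by omega
        rw [h1]
        exact hmax 0 (Finset.mem_range.2 hN)
      · have := hmax (k - 1) (Finset.mem_range.2 (by omega))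
        rwa [show k - 1 + 1 = k by omega] at this
  have hj' := Finset.mem_range.1 hj
  have hM : y (j + 1) ≤ C / (a - 1 - β) := by
    rw [le_div_iff₀ (by linarith)]
    have e1 := h j hj'
    have e2 := hall (j + 2) (by omega)
    have e3 := mul_le_mul_of_nonneg_left (hall j (by omega)) hβ
    linarith
  exact fun k hk => (hall k hk).trans hM

/-- Backward geometric decay: going down from index `p + j` to `p`, a sequence that expands
by `ρ > 1` up to an error `η` loses a factor `ρ ^ j`. -/
theorem le_of_backward_expansion {ρ η : ℝ} (hρ : 1 < ρ) (hη : 0 ≤ η) {y : ℕ → ℝ} {M : ℝ} (j : ℕ) :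
    ∀ p : ℕ, (∀ k, p ≤ k → k < p + j → ρ * y k ≤ y (k + 1) + η) → y (p + j) ≤ M →
      y p ≤ M / ρ ^ j + η / (ρ - 1) := by
  have hρ0 : 0 < ρ := by linarith
  have hρ1 : 0 < ρ - 1 := by linarith
  induction j with
  | zero =>
    intro p _ hM
    have := div_nonneg hη hρ1.le
    simpa using hM.trans (by linarith)
  | succ j ih =>
    intro p h hM
    have h1 := ih (p + 1) (fun k hk hk' => h k (by omega) (by omega))
      (by rwa [show p + 1 + j = p + (j + 1) by omega])
    have h2 := h p le_rfl (by omega)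
    have h3 : M / ρ ^ (j + 1) + η / (ρ - 1) = (M / ρ ^ j + η / (ρ - 1) + η) / ρ := by
      field_simp
      ring
    rw [h3, le_div_iff₀ hρ0]
    linarith

/-- The sequence `u` solves the cyclic recurrence of length `N` with signs `s`.  When
`u (k + 1) = x_k + 1` for the first coordinates `x_k` of a formal periodic orbit of the Lozi map
this is the equation of the orbit; the shift by `1` moves the fixed point `x = -1` of the branch
with negative sign to `u = 0`. -/
structure IsCyclicOrbit (a b : ℝ) (N : ℕ) (s : ℕ → ℤˣ) (u : ℕ → ℝ) : Prop where
  wrap_zero : u N = u 0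
  wrap_one : u (N + 1) = u 1
  step : ∀ k < N, u (k + 2) = a - ((s k : ℤ) : ℝ) * a * (u (k + 1) - 1) - b * u k

theorem abs_sign (σ : ℤˣ) : |((σ : ℤ) : ℝ)| = 1 := by
  rcases Int.units_eq_one_or σ with rfl | rfl <;> simp

theorem IsCyclicOrbit.abs_sub_one_le {a b : ℝ} {N : ℕ} {s : ℕ → ℤˣ} {u : ℕ → ℝ}
    (h : IsCyclicOrbit a b N s u) (hN : 0 < N) (hab : 1 + |b| < a) :
    ∀ k ≤ N + 1, |u k - 1| ≤ |a - 1 - b| / (a - 1 - |b|) := by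
  refine cyclic_le (y := fun k => |u k - 1|) hN (by simp [h.wrap_zero]) (by simp [h.wrap_one])
    (abs_nonneg b) hab fun k hk => ?_
  have ha : 0 < a := by linarith [abs_nonneg b]
  have e := h.step k hk
  calc a * |u (k + 1) - 1| = |((s k : ℤ) : ℝ) * a * (u (k + 1) - 1)| := by
        rw [abs_mul, abs_mul, abs_sign, abs_of_pos ha, one_mul]
    _ = |-(u (k + 2) - 1) + -(b * (u k - 1)) + (a - 1 - b)| := by congr 1; linarith
    _ ≤ |-(u (k + 2) - 1)| + |-(b * (u k - 1))| + |a - 1 - b| := abs_add_three _ _ _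
    _ = _ := by rw [abs_neg, abs_neg, abs_mul]

/-- For `b ≥ 0` the orbit stays in the square `|x| ≤ 1`. -/
theorem IsCyclicOrbit.abs_sub_one_le_one {a b : ℝ} {N : ℕ} {s : ℕ → ℤˣ} {u : ℕ → ℝ}
    (h : IsCyclicOrbit a b N s u) (hN : 0 < N) (hb : 0 ≤ b) (hab : 1 + b < a) :
    ∀ k ≤ N + 1, |u k - 1| ≤ 1 := by
  intro k hk
  have := h.abs_sub_one_le hN (by rwa [abs_of_nonneg hb]) k hk
  rwa [abs_of_nonneg hb, abs_of_pos (show 0 < a - 1 - b by linarith),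
    div_self (by linarith)] at this

/-- The difference of the orbits at two parameters with the same signs is bounded by the
difference of the parameters. -/
theorem IsCyclicOrbit.abs_sub_le {a b a' b' : ℝ} {N : ℕ} {s : ℕ → ℤˣ} {u u' : ℕ → ℝ}
    (h : IsCyclicOrbit a b N s u) (h' : IsCyclicOrbit a' b' N s u') (hN : 0 < N)
    (hab : 1 + |b'| < a') {B : ℝ} (hB : ∀ k ≤ N + 1, |u k - 1| ≤ B) :
    ∀ k ≤ N + 1, |u' k - u k| ≤
      ((1 + B) * (|a' - a| + |b' - b|)) / (a' - 1 - |b'|) := by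
  refine cyclic_le (y := fun k => |u' k - u k|) hN (by simp [h.wrap_zero, h'.wrap_zero])
    (by simp [h.wrap_one, h'.wrap_one]) (abs_nonneg b') hab fun k hk => ?_
  have ha : 0 < a' := by linarith [abs_nonneg b']
  have e := h.step k hk
  have e' := h'.step k hk
  have hB1 := hB (k + 1) (by omega)
  have hB0 := hB k (by omega)
  have f1 : |(a' - a) * (1 - ((s k : ℤ) : ℝ) * (u (k + 1) - 1))| ≤ (1 + B) * |a' - a| := by
    rw [abs_mul, mul_comm]
    refine mul_le_mul_of_nonneg_right ((abs_sub _ _).trans ?_) (abs_nonneg _)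
    rw [abs_mul, abs_sign, abs_one]; linarith
  have f2 : |(b' - b) * u k| ≤ (1 + B) * |b' - b| := by
    rw [abs_mul, mul_comm]
    refine mul_le_mul_of_nonneg_right ?_ (abs_nonneg _)
    calc |u k| = |1 + (u k - 1)| := by congr 1; ring
      _ ≤ 1 + B := (abs_add_le _ _).trans (by rw [abs_one]; linarith)
  calc a' * |u' (k + 1) - u (k + 1)|
      = |((s k : ℤ) : ℝ) * a' * (u' (k + 1) - u (k + 1))| := by
        rw [abs_mul, abs_mul, abs_sign, abs_of_pos ha, one_mul]
    _ = |-(u' (k + 2) - u (k + 2)) + -(b' * (u' k - u k))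
          + ((a' - a) * (1 - ((s k : ℤ) : ℝ) * (u (k + 1) - 1)) - (b' - b) * u k)| := by
        congr 1; rw [e, e']; ring
    _ ≤ |-(u' (k + 2) - u (k + 2))| + |-(b' * (u' k - u k))|
          + |(a' - a) * (1 - ((s k : ℤ) : ℝ) * (u (k + 1) - 1)) - (b' - b) * u k| :=
        abs_add_three _ _ _
    _ ≤ |u' (k + 2) - u (k + 2)| + |b'| * |u' k - u k|
          + (1 + B) * (|a' - a| + |b' - b|) := by
        rw [abs_neg, abs_neg, abs_mul b']
        have := abs_sub ((a' - a) * (1 - ((s k : ℤ) : ℝ) * (u (k + 1) - 1))) ((b' - b) * u k)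
        linarith

/-! ### Formal orbits as cyclic sequences -/

theorem formalIterate_take_succ {a b : ℝ} {I : List ℤˣ} {θ : ℝ × ℝ} {k : ℕ} (hk : k < I.length) :
    formalIterate a b (I.take (k + 1)) θ = branch a b I[k] (formalIterate a b (I.take k) θ) := by
  have h5 : I.take (k + 1) = I.take k ++ [I[k]] := by simp
  unfold formalIterate
  rw [h5, List.foldl_append]
  rfl

/-- The first coordinates of the formal orbit of `θ = (x_0, x_{-1})`, raised by `1` and numbered
from `x_{-1}` on. -/
def orbitSeq (a b : ℝ) (I : List ℤˣ) (θ : ℝ × ℝ) : ℕ → ℝ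
  | 0 => θ.2 + 1
  | k + 1 => (formalIterate a b (I.take k) θ).1 + 1

theorem formalIterate_take_snd {a b : ℝ} {I : List ℤˣ} {θ : ℝ × ℝ} :
    ∀ k ≤ I.length, (formalIterate a b (I.take k) θ).2 + 1 = orbitSeq a b I θ k
  | 0, _ => by simp [formalIterate, orbitSeq]
  | k + 1, hk => by rw [formalIterate_take_succ hk]; rfl

theorem orbitSeq_step {a b : ℝ} {I : List ℤˣ} {θ : ℝ × ℝ} {k : ℕ} (hk : k < I.length) :
    orbitSeq a b I θ (k + 2) = a - ((I[k] : ℤ) : ℝ) * a * (orbitSeq a b I θ (k + 1) - 1)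
      - b * orbitSeq a b I θ k := by
  rw [← formalIterate_take_snd k hk.le]
  simp only [orbitSeq]
  rw [formalIterate_take_succ hk]
  simp only [branch]
  ring

theorem IsFormalPeriodic.isCyclicOrbit {a b : ℝ} {I : List ℤˣ} {θ : ℝ × ℝ}
    (h : IsFormalPeriodic a b I θ) {s : ℕ → ℤˣ} (hs : ∀ k (hk : k < I.length), I[k] = s k) :
    IsCyclicOrbit a b I.length s (orbitSeq a b I θ) where
  wrap_zero := by
    rw [← formalIterate_take_snd _ le_rfl, List.take_length, show formalIterate a b I θ = θ from h]
    rfl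
  wrap_one := by
    simp only [orbitSeq, List.take_length, List.take_zero]
    rw [show formalIterate a b I θ = θ from h]
    rfl
  step k hk := by rw [orbitSeq_step hk, hs k hk]

/-- A formal periodic point is determined by its equation: the difference of two solutions of
`Λ_I z - z = const` is a cyclic sequence without forcing. -/
theorem eq_of_formalIterate_sub_eq {a b : ℝ} {I : List ℤˣ} (hI : 0 < I.length)
    (hab : 1 + |b| < a) {z w : ℝ × ℝ}
    (h : formalIterate a b I z - formalIterate a b I w = z - w) : z = w := by
  set y : ℕ → ℝ := fun k => |orbitSeq a b I z k - orbitSeq a b I w k| with hy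
  have ha : 0 < a := by linarith [abs_nonneg b]
  have h1 := congrArg Prod.fst h
  have h2 := congrArg Prod.snd h
  simp only [Prod.fst_sub, Prod.snd_sub] at h1 h2
  have key := cyclic_le (y := y) (C := 0) hI
    (by
      have e1 := formalIterate_take_snd (a := a) (b := b) (θ := z) I.length le_rfl
      have e2 := formalIterate_take_snd (a := a) (b := b) (θ := w) I.length le_rfl
      rw [List.take_length] at e1 e2
      simp only [hy, ← e1, ← e2]
      simp only [orbitSeq]
      congr 1; linarith)
    (by
      simp only [hy, orbitSeq, List.take_length, List.take_zero]
      congr 1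
      simp only [formalIterate, List.foldl_nil] at h1 ⊢
      linarith)
    (abs_nonneg b) hab fun k hk => by
      simp only [hy]
      rw [orbitSeq_step hk, orbitSeq_step hk]
      generalize orbitSeq a b I z k = p
      generalize orbitSeq a b I w k = q
      generalize orbitSeq a b I z (k + 1) = p'
      generalize orbitSeq a b I w (k + 1) = q'
      calc a * |p' - q'| = |((I[k] : ℤ) : ℝ) * a * (p' - q')| := by
            rw [abs_mul, abs_mul, abs_sign, abs_of_pos ha, one_mul]
        _ = |-(a - ((I[k] : ℤ) : ℝ) * a * (p' - 1) - b * p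
              - (a - ((I[k] : ℤ) : ℝ) * a * (q' - 1) - b * q)) + -(b * (p - q))| := by
            congr 1; ring
        _ ≤ _ := (abs_add_le _ _).trans (by rw [abs_neg, abs_neg, abs_mul b]; linarith)
  simp only [zero_div] at key
  have k0 := abs_nonpos_iff.1 (key 0 (by omega))
  have k1 := abs_nonpos_iff.1 (key 1 (by omega))
  simp only [orbitSeq, formalIterate, List.take_zero, List.foldl_nil] at k0 k1
  exact Prod.ext (by linarith) (by linarith)

/-! ### The itineraries `ι_{σ,m,n}` -/

/-- The symbols of `ι_{σ,m,n}` as a function of the position, counted from `0`. -/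
def iotaSign (σ : ℤˣ) (m n k : ℕ) : ℤˣ :=
  if k = 0 ∨ k = m - 1 ∨ k = m then 1 else if k = m + n - 1 then σ else -1

theorem length_iota {σ : ℤˣ} {m n : ℕ} (hm : 2 ≤ m) (hn : 2 ≤ n) :
    (iota σ m n).length = m + n := by
  simp [iota]; omega

theorem getElem_iota {σ : ℤˣ} {m n : ℕ} (hm : 2 ≤ m) (hn : 2 ≤ n) (k : ℕ)
    (hk : k < (iota σ m n).length) : (iota σ m n)[k] = iotaSign σ m n k := by
  have hk' := hk
  rw [length_iota hm hn] at hk'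
  unfold iotaSign
  simp only [iota, List.getElem_append, List.getElem_replicate, List.length_append,
    List.length_replicate, List.length_cons, List.length_nil, List.getElem_cons]
  grind

theorem IsFormalPeriodic.isCyclicOrbit_iota {a b : ℝ} {σ : ℤˣ} {m n : ℕ} (hm : 2 ≤ m)
    (hn : 2 ≤ n) {θ : ℝ × ℝ} (h : IsFormalPeriodic a b (iota σ m n) θ) :
    IsCyclicOrbit a b (m + n) (iotaSign σ m n) (orbitSeq a b (iota σ m n) θ) := by
  have := h.isCyclicOrbit (getElem_iota hm hn)
  rwa [length_iota hm hn] at this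

section Recurrence

variable {a b : ℝ} {σ : ℤˣ} {m n : ℕ} {u : ℕ → ℝ}

theorem IsCyclicOrbit.two (h : IsCyclicOrbit a b (m + n) (iotaSign σ m n) u) (hm : 4 ≤ m) :
    u 2 = 2 * a - a * u 1 - b * u 0 := by
  have := h.step 0 (by omega)
  simp [iotaSign] at this
  linarith

theorem IsCyclicOrbit.left (h : IsCyclicOrbit a b (m + n) (iotaSign σ m n) u) {k : ℕ}
    (hk : 1 ≤ k) (hk' : k + 2 ≤ m) : u (k + 2) = a * u (k + 1) - b * u k := by
  have := h.step k (by omega)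
  rw [iotaSign, if_neg (by omega), if_neg (by omega)] at this
  push_cast at this
  linarith

theorem IsCyclicOrbit.mid (h : IsCyclicOrbit a b (m + n) (iotaSign σ m n) u) (hm : 4 ≤ m) :
    u (m + 1) = 2 * a - a * u m - b * u (m - 1) := by
  have := h.step (m - 1) (by omega)
  rw [iotaSign, if_pos (by omega), show m - 1 + 2 = m + 1 by omega,
    show m - 1 + 1 = m by omega] at this
  push_cast at this
  linarith

theorem IsCyclicOrbit.mid_succ (h : IsCyclicOrbit a b (m + n) (iotaSign σ m n) u) (hn : 2 ≤ n) :
    u (m + 2) = 2 * a - a * u (m + 1) - b * u m := by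
  have := h.step m (by omega)
  rw [iotaSign, if_pos (by omega)] at this
  push_cast at this
  linarith

theorem IsCyclicOrbit.right (h : IsCyclicOrbit a b (m + 3) (iotaSign σ m 3) u) (hm : 4 ≤ m) :
    u (m + 3) = a * u (m + 2) - b * u (m + 1) := by
  have := h.step (m + 1) (by omega)
  rw [iotaSign, if_neg (by omega), if_neg (by omega)] at this
  push_cast at this
  linarith

theorem IsCyclicOrbit.last (h : IsCyclicOrbit a b (m + n) (iotaSign σ m n) u) (hm : 4 ≤ m)
    (hn : 2 ≤ n) :
    u 1 = a - ((σ : ℤ) : ℝ) * a * (u 0 - 1) - b * u (m + n - 1) := by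
  have := h.step (m + n - 1) (by omega)
  rw [iotaSign, if_neg (by omega), if_pos rfl, show m + n - 1 + 2 = m + n + 1 by omega,
    show m + n - 1 + 1 = m + n by omega, h.wrap_one, h.wrap_zero] at this
  exact this

end Recurrence

/-! ### Orbits for parameters close to `(2, 0)` -/

/-- A cyclic sequence with the signs of `ι_{σ,m,n}`, `n = 2, 3`, for `m` large and a parameter
close to `(a, b) = (2, 0)`.  Negative `b` is allowed, so that the bifurcation curves extend
across `b = 0`.  The bound on `m` leaves room for two stretches of `20` steps, over each of which
the expansion by `1.9` makes the influence of the far end negligible. -/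
structure IsWindowOrbit (a b : ℝ) (σ : ℤˣ) (m n : ℕ) (u : ℕ → ℝ) : Prop
    extends IsCyclicOrbit a b (m + n) (iotaSign σ m n) u where
  m_large : 60 ≤ m
  n_mem : n = 2 ∨ n = 3
  a_mem : a ∈ Set.Icc (2 - 1 / 50 : ℝ) (2 + 1 / 50)
  b_mem : |b| ≤ 1 / 1000

theorem abs_mul_le_div {b x B : ℝ} (hb : |b| ≤ 1 / 1000) (hx : |x| ≤ B) :
    |b * x| ≤ B / 1000 := by
  rw [abs_mul]
  have := mul_le_mul hb hx (abs_nonneg _) (by norm_num)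
  linarith

theorem abs_le_of_abs_mul_le {c x B : ℝ} (hc : 1.98 ≤ c) (h : |c * x| ≤ 1.98 * B) :
    |x| ≤ B := by
  rw [abs_mul, abs_of_pos (by linarith)] at h
  nlinarith [abs_nonneg x]

namespace IsWindowOrbit

section Bounds

variable {a b : ℝ} {σ : ℤˣ} {m n : ℕ} {u : ℕ → ℝ}

theorem abs_sub_one_le (h : IsWindowOrbit a b σ m n u) {k : ℕ} (hk : k ≤ m + n + 1) :
    |u k - 1| ≤ 1.01 := by
  obtain ⟨ha1, ha2⟩ := h.a_mem
  have hb := h.b_mem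
  have hm := h.m_large
  refine (h.toIsCyclicOrbit.abs_sub_one_le (by omega) (by linarith) k hk).trans ?_
  rw [div_le_iff₀ (by linarith)]
  have : |a - 1 - b| ≤ (a - 1) + |b| := by
    rw [abs_le]; constructor <;> linarith [neg_abs_le b, le_abs_self b]
  linarith

theorem abs_le (h : IsWindowOrbit a b σ m n u) {k : ℕ} (hk : k ≤ m + n + 1) :
    |u k| ≤ 2.01 := by
  have := _root_.abs_le.1 (h.abs_sub_one_le hk)
  rw [_root_.abs_le]; constructor <;> linarith

theorem abs_mul_le (h : IsWindowOrbit a b σ m n u) {k : ℕ} (hk : k ≤ m + n + 1) :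
    |b * u k| ≤ 0.0021 :=
  (abs_mul_le_div h.b_mem (h.abs_le hk)).trans (by norm_num)

/-- Along the long run of negative symbols the orbit leaves the fixed point `u = 0` only at the
end. -/
theorem abs_le_of_le (h : IsWindowOrbit a b σ m n u) {k : ℕ} (hk : 2 ≤ k) (hk' : k + 20 ≤ m) :
    |u k| ≤ 0.003 := by
  obtain ⟨ha1, ha2⟩ := h.a_mem
  have hm := h.m_large
  have key := le_of_backward_expansion (ρ := 1.9) (η := 0.0021) (by norm_num) (by norm_num)
    (y := fun j => |u j|) (M := 2.01) 20 k (fun j hj hj' => by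
      have e := h.left (k := j - 1) (by omega) (by omega)
      rw [show j - 1 + 2 = j + 1 by omega, show j - 1 + 1 = j by omega] at e
      have e2 := h.abs_mul_le (k := j - 1) (by omega)
      calc 1.9 * |u j| ≤ a * |u j| := mul_le_mul_of_nonneg_right (by linarith) (abs_nonneg _)
        _ = |u (j + 1) + b * u (j - 1)| := by
            rw [e, sub_add_cancel, abs_mul, abs_of_pos (by linarith : 0 < a)]
        _ ≤ _ := (abs_add_le _ _).trans (by linarith))
    (h.abs_le (by omega))
  refine key.trans ?_
  norm_num

theorem abs_one_sub_two_le (h : IsWindowOrbit a b σ m n u) : |u 1 - 2| ≤ 0.003 := by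
  obtain ⟨ha1, ha2⟩ := h.a_mem
  have hm := h.m_large
  have e := h.two (by omega)
  have e0 := _root_.abs_le.1 (h.abs_mul_le (k := 0) (by omega))
  have e2 := _root_.abs_le.1 (h.abs_le_of_le (k := 2) le_rfl (by omega))
  rw [_root_.abs_le]
  constructor <;> nlinarith

/-- `σ (u 0 - 1)` is the height over the border `x = 0` of the orbit at the place of the symbol
`σ`. -/
theorem abs_height_sub_le (h : IsWindowOrbit a b σ m n u) :
    |a * (((σ : ℤ) : ℝ) * (u 0 - 1)) - (a - 2)| ≤ 0.0051 := by
  have hm := h.m_large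
  have hn : 2 ≤ n := by rcases h.n_mem with hn | hn <;> omega
  have e := h.last (by omega) hn
  have e0 := _root_.abs_le.1 (h.abs_mul_le (k := m + n - 1) (by omega))
  have e1 := _root_.abs_le.1 h.abs_one_sub_two_le
  rw [_root_.abs_le]
  constructor <;> linarith

theorem abs_zero_sub_one_le (h : IsWindowOrbit a b σ m n u) : |u 0 - 1| ≤ 0.015 := by
  obtain ⟨ha1, ha2⟩ := h.a_mem
  have e := _root_.abs_le.1 h.abs_height_sub_le
  rw [show |u 0 - 1| = |((σ : ℤ) : ℝ) * (u 0 - 1)| by rw [abs_mul, abs_sign, one_mul],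
    _root_.abs_le]
  constructor <;> nlinarith

theorem prev_mem_of_two (h : IsWindowOrbit a b σ m 2 u) :
    u (m + 1) ∈ Set.Icc (1.48 : ℝ) 1.52 := by
  obtain ⟨ha1, ha2⟩ := h.a_mem
  have e := h.mid_succ le_rfl
  rw [h.wrap_zero] at e
  have e0 := _root_.abs_le.1 (h.abs_mul_le (k := m) (by omega))
  have e1 := _root_.abs_le.1 h.abs_zero_sub_one_le
  constructor <;> nlinarith

theorem prev_mem_of_three (h : IsWindowOrbit a b σ m 3 u) :
    u (m + 2) ∈ Set.Icc (0.48 : ℝ) 0.52 := by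
  obtain ⟨ha1, ha2⟩ := h.a_mem
  have hm := h.m_large
  have e := h.right (by omega)
  rw [h.wrap_zero] at e
  have e0 := _root_.abs_le.1 (h.abs_mul_le (k := m + 1) (by omega))
  have e1 := _root_.abs_le.1 h.abs_zero_sub_one_le
  constructor <;> nlinarith

theorem succ_mem (h : IsWindowOrbit a b σ m n u) : u (m + 1) ∈ Set.Icc (1.4 : ℝ) 1.8 := by
  obtain ⟨ha1, ha2⟩ := h.a_mem
  rcases h.n_mem with rfl | rfl
  · have := h.prev_mem_of_two
    constructor <;> linarith [this.1, this.2]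
  · have h2 := h.prev_mem_of_three
    have e := h.mid_succ (by omega)
    have e0 := _root_.abs_le.1 (h.abs_mul_le (k := m) (by omega))
    constructor <;> nlinarith [h2.1, h2.2]

theorem mid_mem (h : IsWindowOrbit a b σ m n u) : u m ∈ Set.Icc (1.05 : ℝ) 1.35 := by
  obtain ⟨ha1, ha2⟩ := h.a_mem
  have hm := h.m_large
  have h2 := h.succ_mem
  have e := h.mid (by omega)
  have e0 := _root_.abs_le.1 (h.abs_mul_le (k := m - 1) (by omega))
  constructor <;> nlinarith [h2.1, h2.2]

theorem lt_one_of_lt (h : IsWindowOrbit a b σ m n u) {k : ℕ} (hk : 2 ≤ k) (hk' : k < m) :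
    u k < 1 := by
  obtain ⟨ha1, ha2⟩ := h.a_mem
  have hm := h.m_large
  have step : ∀ j, 2 ≤ j → j < m → u (j + 1) ≤ 1.35 → u j ≤ 0.7 := by
    intro j hj hj' hu
    have e := h.left (k := j - 1) (by omega) (by omega)
    rw [show j - 1 + 2 = j + 1 by omega, show j - 1 + 1 = j by omega] at e
    have e0 := _root_.abs_le.1 (h.abs_mul_le (k := j - 1) (by omega))
    by_contra hc
    nlinarith
  have key : ∀ i, i + 2 ≤ m → u (m - i) ≤ 1.35 := by
    intro i
    induction i with
    | zero => intro _; exact h.mid_mem.2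
    | succ i ih =>
      intro hi
      have := step (m - (i + 1)) (by omega) (by omega)
        (by rw [show m - (i + 1) + 1 = m - i by omega]; exact ih (by omega))
      linarith
  have := step k hk hk' (by
    have := key (m - (k + 1)) (by omega)
    rwa [show m - (m - (k + 1)) = k + 1 by omega] at this)
  linarith

/-- All admissibility conditions except the one at the last place hold strictly. -/
theorem sign_mul_pos (h : IsWindowOrbit a b σ m n u) {k : ℕ} (hk : k + 1 < m + n) :
    0 < ((iotaSign σ m n k : ℤ) : ℝ) * (u (k + 1) - 1) := by
  have hm := h.m_large
  by_cases h1 : k = 0 ∨ k = m - 1 ∨ k = m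
  · rw [iotaSign, if_pos h1]
    rcases h1 with rfl | rfl | rfl
    · have := _root_.abs_le.1 h.abs_one_sub_two_le
      simp only [zero_add]; push_cast; linarith
    · have := h.mid_mem.1
      rw [show m - 1 + 1 = m by omega]; push_cast; linarith
    · have := h.succ_mem.1
      push_cast; linarith
  · rw [iotaSign, if_neg h1, if_neg (by omega)]
    have : u (k + 1) < 1 := by
      rcases Nat.lt_or_ge (k + 1) m with h2 | h2
      · exact h.lt_one_of_lt (by omega) h2
      · rcases h.n_mem with rfl | rfl
        · omega
        · obtain rfl : k = m + 1 := by omega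
          linarith [h.prev_mem_of_three.2]
    push_cast; linarith

end Bounds

section Difference

variable {a b a' b' : ℝ} {σ : ℤˣ} {m n : ℕ} {u u' : ℕ → ℝ}

theorem abs_diff_le (h : IsWindowOrbit a b σ m n u) (h' : IsWindowOrbit a' b' σ m n u') {k : ℕ}
    (hk : k ≤ m + n + 1) : |u' k - u k| ≤ 2.1 * (|a' - a| + |b' - b|) := by
  obtain ⟨ha1, ha2⟩ := h'.a_mem
  have hb := h'.b_mem
  have hm := h.m_large
  refine (h.toIsCyclicOrbit.abs_sub_le h'.toIsCyclicOrbit (by omega) (by linarith)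
    (fun j hj => h.abs_sub_one_le hj) k hk).trans ?_
  rw [div_le_iff₀ (by linarith)]
  have := add_nonneg (abs_nonneg (a' - a)) (abs_nonneg (b' - b))
  nlinarith

theorem abs_mul_diff_le (h : IsWindowOrbit a b σ m n u) (h' : IsWindowOrbit a' b' σ m n u')
    {k : ℕ} (hk : k ≤ m + n + 1) :
    |b' * (u' k - u k)| ≤ 0.0021 * (|a' - a| + |b' - b|) :=
  (abs_mul_le_div h'.b_mem (h.abs_diff_le h' hk)).trans (by linarith)

theorem abs_diff_three_le (h : IsWindowOrbit a b σ m n u) (h' : IsWindowOrbit a' b' σ m n u') :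
    |u' 3 - u 3| ≤ 0.02 * (|a' - a| + |b' - b|) := by
  obtain ⟨ha1, ha2⟩ := h'.a_mem
  have hm := h.m_large
  set D := |a' - a| + |b' - b| with hD
  have hD0 : 0 ≤ D := add_nonneg (abs_nonneg _) (abs_nonneg _)
  have key := le_of_backward_expansion (ρ := 1.9) (η := 0.01 * D) (by norm_num) (by positivity)
    (y := fun j => |u' j - u j|) (M := 2.1 * D) 20 3 (fun j hj hj' => by
      have e := h.left (k := j - 1) (by omega) (by omega)
      have e' := h'.left (k := j - 1) (by omega) (by omega)
      rw [show j - 1 + 2 = j + 1 by omega, show j - 1 + 1 = j by omega] at e e'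
      have e2 := _root_.abs_le.1 (h.abs_mul_diff_le h' (k := j - 1) (by omega))
      have s1 : |(a' - a) * u j| ≤ |a' - a| * 0.003 := by
        rw [abs_mul]
        exact mul_le_mul_of_nonneg_left (h.abs_le_of_le (by omega) (by omega)) (abs_nonneg _)
      have s2 : |(b' - b) * u (j - 1)| ≤ |b' - b| * 0.003 := by
        rw [abs_mul]
        exact mul_le_mul_of_nonneg_left (h.abs_le_of_le (by omega) (by omega)) (abs_nonneg _)
      have t1 := _root_.abs_le.1 s1
      have t2 := _root_.abs_le.1 s2
      calc 1.9 * |u' j - u j| ≤ a' * |u' j - u j| :=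
            mul_le_mul_of_nonneg_right (by linarith) (abs_nonneg _)
        _ = |(u' (j + 1) - u (j + 1)) +
              (b' * (u' (j - 1) - u (j - 1)) + (b' - b) * u (j - 1) - (a' - a) * u j)| := by
            rw [← abs_of_pos (by linarith : 0 < a'), ← abs_mul, e, e',
              abs_of_pos (by linarith : 0 < a')]
            congr 1; ring
        _ ≤ |u' (j + 1) - u (j + 1)| + 0.01 * D := by
            refine (abs_add_le _ _).trans (add_le_add_right ?_ _)
            rw [_root_.abs_le]
            constructor <;> linarith [abs_nonneg (a' - a), abs_nonneg (b' - b)])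
    (h.abs_diff_le h' (by omega))
  refine key.trans ?_
  norm_num
  linarith

/-- First order expansion of the height over the border in the parameters: `2 dt = da - (w - 1) db`
up to an error, where `w` is the term before the last place. -/
theorem abs_height_diff_le (h : IsWindowOrbit a b σ m n u) (h' : IsWindowOrbit a' b' σ m n u') :
    |a' * (((σ : ℤ) : ℝ) * (u' 0 - 1) - ((σ : ℤ) : ℝ) * (u 0 - 1))
        - (a' - a) + (b' - b) * (u (m + n - 1) - 1)| ≤ 0.1 * (|a' - a| + |b' - b|) := by
  obtain ⟨ha1, ha2⟩ := h'.a_mem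
  have hm := h.m_large
  have hn : 2 ≤ n := by rcases h.n_mem with hn | hn <;> omega
  have d3 := _root_.abs_le.1 (h.abs_diff_three_le h')
  have d0 := _root_.abs_le.1 (h.abs_mul_diff_le h' (k := 0) (by omega))
  have d1 := _root_.abs_le.1 (h.abs_mul_diff_le h' (k := 1) (by omega))
  have dw := _root_.abs_le.1 (h.abs_mul_diff_le h' (k := m + n - 1) (by omega))
  have pr : ∀ {c x B : ℝ}, |x| ≤ B → |c * x| ≤ |c| * B := fun {c x B} hx => by
    rw [abs_mul]; exact mul_le_mul_of_nonneg_left hx (abs_nonneg _)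
  have p1 := _root_.abs_le.1 (pr (c := a' - a) (h.abs_le_of_le (k := 2) le_rfl (by omega)))
  have p2 := _root_.abs_le.1 (pr (c := a' - a) h.abs_one_sub_two_le)
  have p3 := _root_.abs_le.1 (pr (c := b' - b) h.abs_one_sub_two_le)
  have p4 := _root_.abs_le.1 (pr (c := b' - b) h.abs_zero_sub_one_le)
  have p5 := _root_.abs_le.1 (pr (c := a' - a)
    (show |((σ : ℤ) : ℝ) * (u 0 - 1)| ≤ 0.015 by
      rw [abs_mul, abs_sign, one_mul]; exact h.abs_zero_sub_one_le))
  have e1 := h.last (by omega) hn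
  have e1' := h'.last (by omega) hn
  have e2 := h.two (by omega)
  have e2' := h'.two (by omega)
  have e3 := h.left (k := 1) le_rfl (by omega)
  have e3' := h'.left (k := 1) le_rfl (by omega)
  norm_num at e3 e3'
  have A0 := abs_nonneg (a' - a)
  have B0 := abs_nonneg (b' - b)
  have B1 := le_abs_self (b' - b)
  have B2 := neg_abs_le (b' - b)
  -- the two steps after the last place, in increments
  have z2 : a' * (u' 2 - u 2) = (u' 3 - u 3) - (a' - a) * u 2 + b' * (u' 1 - u 1)
      + (b' - b) * u 1 := by rw [e3, e3']; ring
  have z1 : a' * (u' 1 - u 1) = -(a' - a) * (u 1 - 2) - b' * (u' 0 - u 0) - (b' - b) * u 0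
      - (u' 2 - u 2) := by rw [e2, e2']; ring
  have z0 : a' * (((σ : ℤ) : ℝ) * (u' 0 - 1) - ((σ : ℤ) : ℝ) * (u 0 - 1))
        - (a' - a) + (b' - b) * (u (m + n - 1) - 1) =
      -(u' 1 - u 1) - (b' - b) - (a' - a) * (((σ : ℤ) : ℝ) * (u 0 - 1))
        - b' * (u' (m + n - 1) - u (m + n - 1)) := by rw [e1, e1']; ring
  have p6 := _root_.abs_le.1 (pr (c := b' - b) (show |a' - 2| ≤ 1 / 50 by
    rw [_root_.abs_le]; constructor <;> linarith))
  have y2 : |(u' 2 - u 2) - (b' - b)| ≤ 0.04 * (|a' - a| + |b' - b|) := by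
    refine abs_le_of_abs_mul_le (c := a') (by linarith) ?_
    rw [show a' * ((u' 2 - u 2) - (b' - b)) = (u' 3 - u 3) - (a' - a) * u 2 + b' * (u' 1 - u 1)
      + (b' - b) * (u 1 - 2) - (b' - b) * (a' - 2) by linear_combination z2, _root_.abs_le]
    constructor <;> linarith
  have y2' := _root_.abs_le.1 y2
  have y1 : |(u' 1 - u 1) + (b' - b)| ≤ 0.06 * (|a' - a| + |b' - b|) := by
    refine abs_le_of_abs_mul_le (c := a') (by linarith) ?_
    rw [show a' * ((u' 1 - u 1) + (b' - b)) = -((a' - a) * (u 1 - 2)) - b' * (u' 0 - u 0)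
      - (b' - b) * (u 0 - 1) - ((u' 2 - u 2) - (b' - b)) + (b' - b) * (a' - 2) by
        linear_combination z1, _root_.abs_le]
    constructor <;> linarith
  have y1' := _root_.abs_le.1 y1
  rw [z0, _root_.abs_le]
  constructor <;> linarith

end Difference

end IsWindowOrbit

/-! ### Existence, uniqueness and analyticity of formal periodic points -/

theorem formalIterate_affine (a b : ℝ) (I : List ℤˣ) (x y : ℝ) :
    ∀ p q r : ℝ × ℝ, formalIterate a b I (p + x • (q - p) + y • (r - p)) =
      formalIterate a b I p + x • (formalIterate a b I q - formalIterate a b I p)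
        + y • (formalIterate a b I r - formalIterate a b I p) := by
  induction I with
  | nil => intro p q r; rfl
  | cons s I ih =>
    intro p q r
    have : branch a b s (p + x • (q - p) + y • (r - p)) =
        branch a b s p + x • (branch a b s q - branch a b s p)
          + y • (branch a b s r - branch a b s p) := by
      ext
      · simp [branch]; ring
      · simp [branch]
    simp only [formalIterate, List.foldl_cons] at ih ⊢
    rw [this, ih]

/-- The images under `Λ_I` of the origin and, relative to it, of the two basis vectors: the
translation part and the columns of the linear part of `Λ_I`. -/
def affineParts (a b : ℝ) (I : List ℤˣ) : (ℝ × ℝ) × (ℝ × ℝ) × (ℝ × ℝ) :=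
  (formalIterate a b I 0, formalIterate a b I (1, 0) - formalIterate a b I 0,
    formalIterate a b I (0, 1) - formalIterate a b I 0)

theorem formalIterate_eq_affineParts (a b : ℝ) (I : List ℤˣ) (z : ℝ × ℝ) :
    formalIterate a b I z = (affineParts a b I).1 + z.1 • (affineParts a b I).2.1
      + z.2 • (affineParts a b I).2.2 := by
  have := formalIterate_affine a b I z.1 z.2 0 (1, 0) (0, 1)
  rw [show (0 : ℝ × ℝ) + z.1 • ((1, 0) - 0) + z.2 • ((0, 1) - 0) = z by ext <;> simp] at this
  exact this

/-- The determinant of the identity minus the linear part of `Λ_I`. -/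
def periodicDet (a b : ℝ) (I : List ℤˣ) : ℝ :=
  (1 - (affineParts a b I).2.1.1) * (1 - (affineParts a b I).2.2.2)
    - (affineParts a b I).2.1.2 * (affineParts a b I).2.2.1

/-- The formal periodic point, given by Cramer's rule. -/
noncomputable def periodicPoint (a b : ℝ) (I : List ℤˣ) : ℝ × ℝ :=
  (((1 - (affineParts a b I).2.2.2) * (affineParts a b I).1.1
      + (affineParts a b I).2.2.1 * (affineParts a b I).1.2) / periodicDet a b I,
    ((affineParts a b I).2.1.2 * (affineParts a b I).1.1
      + (1 - (affineParts a b I).2.1.1) * (affineParts a b I).1.2) / periodicDet a b I)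

theorem periodicDet_ne_zero {a b : ℝ} {I : List ℤˣ} (hI : 0 < I.length) (hab : 1 + |b| < a) :
    periodicDet a b I ≠ 0 := by
  intro hdet
  unfold periodicDet at hdet
  have key : ∀ z : ℝ × ℝ, z.1 • (affineParts a b I).2.1 + z.2 • (affineParts a b I).2.2 = z →
      z = 0 := fun z hz => eq_of_formalIterate_sub_eq hI hab (by
    rw [formalIterate_eq_affineParts, formalIterate_eq_affineParts a b I 0, add_assoc, hz]
    simp)
  generalize (affineParts a b I).2.1 = p at *
  generalize (affineParts a b I).2.2 = q at *
  -- the columns of the adjugate are in the kernel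
  have k1 := key (q.1, 1 - p.1) (by ext <;> simp <;> linarith)
  have k2 := key (1 - q.2, p.2) (by ext <;> simp <;> linarith)
  simp only [Prod.mk_eq_zero] at k1 k2
  have k3 := key (1, 0) (by ext <;> simp <;> linarith)
  simp at k3

theorem isFormalPeriodic_iff {a b : ℝ} {I : List ℤˣ} (hI : 0 < I.length) (hab : 1 + |b| < a)
    {θ : ℝ × ℝ} : IsFormalPeriodic a b I θ ↔ θ = periodicPoint a b I := by
  have hP : IsFormalPeriodic a b I (periodicPoint a b I) := by
    have hd := periodicDet_ne_zero hI hab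
    unfold IsFormalPeriodic
    rw [formalIterate_eq_affineParts]
    unfold periodicPoint
    have hd' := hd
    unfold periodicDet at hd'
    ext
    · simp only [Prod.fst_add, Prod.smul_fst, smul_eq_mul]
      field_simp
      unfold periodicDet
      ring
    · simp only [Prod.snd_add, Prod.smul_snd, smul_eq_mul]
      field_simp
      unfold periodicDet
      ring
  refine ⟨fun h => eq_of_formalIterate_sub_eq hI hab ?_, fun h => h ▸ hP⟩
  rw [show formalIterate a b I θ = θ from h,
    show formalIterate a b I (periodicPoint a b I) = _ from hP]

theorem analyticAt_formalIterate (I : List ℤˣ) (p : ℝ × ℝ) :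
    ∀ g : ℝ × ℝ → ℝ × ℝ, AnalyticAt ℝ g p →
      AnalyticAt ℝ (fun q : ℝ × ℝ => formalIterate q.2 q.1 I (g q)) p := by
  induction I with
  | nil => exact fun g hg => hg
  | cons s I ih =>
    intro g hg
    refine ih (fun q => branch q.2 q.1 s (g q)) ?_
    unfold branch
    have h1 : AnalyticAt ℝ (fun q => (g q).1) p := analyticAt_fst.comp hg
    have h2 : AnalyticAt ℝ (fun q => (g q).2) p := analyticAt_snd.comp hg
    exact ((((analyticAt_const.mul analyticAt_snd).mul h1).sub (analyticAt_fst.mul h2)).add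
      ((analyticAt_snd.sub analyticAt_fst).sub analyticAt_const)).prod h1

/-- The formal periodic point depends analytically on the parameter, here in the order
`(b, a)`. -/
theorem analyticAt_periodicPoint_snd {I : List ℤˣ} (hI : 0 < I.length) {p : ℝ × ℝ}
    (hab : 1 + |p.1| < p.2) :
    AnalyticAt ℝ (fun q : ℝ × ℝ => (periodicPoint q.2 q.1 I).2) p := by
  have h0 := analyticAt_formalIterate I p (fun _ => 0) analyticAt_const
  have h1 := analyticAt_formalIterate I p (fun _ => (1, 0)) analyticAt_const
  have h2 := analyticAt_formalIterate I p (fun _ => (0, 1)) analyticAt_const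
  have h01 : AnalyticAt ℝ (fun q : ℝ × ℝ => (formalIterate q.2 q.1 I 0).1) p :=
    analyticAt_fst.comp h0
  have h02 : AnalyticAt ℝ (fun q : ℝ × ℝ => (formalIterate q.2 q.1 I 0).2) p :=
    analyticAt_snd.comp h0
  have h11 : AnalyticAt ℝ (fun q : ℝ × ℝ => (formalIterate q.2 q.1 I (1, 0)).1) p :=
    analyticAt_fst.comp h1
  have h12 : AnalyticAt ℝ (fun q : ℝ × ℝ => (formalIterate q.2 q.1 I (1, 0)).2) p :=
    analyticAt_snd.comp h1
  have h21 : AnalyticAt ℝ (fun q : ℝ × ℝ => (formalIterate q.2 q.1 I (0, 1)).1) p :=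
    analyticAt_fst.comp h2
  have h22 : AnalyticAt ℝ (fun q : ℝ × ℝ => (formalIterate q.2 q.1 I (0, 1)).2) p :=
    analyticAt_snd.comp h2
  have hd := periodicDet_ne_zero hI hab
  unfold periodicDet at hd
  simp only [periodicPoint, periodicDet, affineParts, Prod.fst_sub, Prod.snd_sub] at hd ⊢
  refine AnalyticAt.div ?_ ?_ hd <;> fun_prop

/-! ### Admissibility away from the window -/

theorem isAdmissible_iff {a b : ℝ} {σ : ℤˣ} {m n : ℕ} (hm : 2 ≤ m) (hn : 2 ≤ n) {θ : ℝ × ℝ} :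
    IsAdmissible a b (iota σ m n) θ ↔
      ∀ k < m + n, 0 ≤ ((iotaSign σ m n k : ℤ) : ℝ) * (orbitSeq a b (iota σ m n) θ (k + 1) - 1) := by
  have hl := length_iota (σ := σ) hm hn
  constructor
  · intro h k hk
    have := h k (by omega)
    rw [getElem_iota hm hn] at this
    simpa [orbitSeq] using this
  · intro h k hk
    have := h k (by omega)
    rw [getElem_iota hm hn]
    simpa [orbitSeq] using this

/-- For `a > 2 + 2 b` every cyclic orbit is admissible, and stays off the border. -/
theorem IsCyclicOrbit.sign_mul_pos {a b : ℝ} {N : ℕ} {s : ℕ → ℤˣ} {u : ℕ → ℝ}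
    (h : IsCyclicOrbit a b N s u) (hb : 0 ≤ b) (hab : 2 + 2 * b < a) {k : ℕ} (hk : k < N) :
    0 < ((s k : ℤ) : ℝ) * (u (k + 1) - 1) := by
  have e := h.step k hk
  have h0 := abs_le.1 (h.abs_sub_one_le_one (by omega) hb (by linarith) k (by omega))
  have h2 := abs_le.1 (h.abs_sub_one_le_one (by omega) hb (by linarith) (k + 2) (by omega))
  have : 0 < a * (((s k : ℤ) : ℝ) * (u (k + 1) - 1)) := by nlinarith
  exact (mul_pos_iff_of_pos_left (by linarith)).1 this

section Small

variable {a b : ℝ} {σ : ℤˣ} {m n : ℕ} {u : ℕ → ℝ}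

theorem IsCyclicOrbit.le_one_of_admissible
    (hadm : ∀ k < m + n, 0 ≤ ((iotaSign σ m n k : ℤ) : ℝ) * (u (k + 1) - 1))
    {k : ℕ} (hk : 2 ≤ k) (hk' : k < m) : u k ≤ 1 := by
  have := hadm (k - 1) (by omega)
  rw [iotaSign, if_neg (by omega), if_neg (by omega), show k - 1 + 1 = k by omega] at this
  push_cast at this
  linarith

/-- For `a ≤ 3 / 2` the term before the last place of an admissible orbit lies at most
`0.51 (a - b - 1)` below the border. -/
theorem IsCyclicOrbit.prev_lower_bound (h : IsCyclicOrbit a b (m + n) (iotaSign σ m n) u)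
    (hm : 60 ≤ m) (hn : n = 2 ∨ n = 3) (hb : 0 ≤ b) (hb' : b ≤ 1 / 1000)
    (hab : 1 + 3 * b < a) (ha : a ≤ 3 / 2)
    (hadm : ∀ k < m + n, 0 ≤ ((iotaSign σ m n k : ℤ) : ℝ) * (u (k + 1) - 1)) :
    -(0.51 * (a - b - 1)) ≤ u (m + n - 1) - 1 := by
  have hx := fun k hk => abs_le.1 (h.abs_sub_one_le_one (by omega) hb (by linarith) k hk)
  have hM := hadm (m - 1) (by omega)
  rw [iotaSign, if_pos (by omega), show m - 1 + 1 = m by omega] at hM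
  have hM1 := hadm m (by omega)
  rw [iotaSign, if_pos (by omega)] at hM1
  push_cast at hM hM1
  rcases hn with rfl | rfl
  · rw [show m + 2 - 1 = m + 1 by omega]
    linarith
  · have hv := hx (m - 2) (by omega)
    have e0 := h.left (k := m - 2) (by omega) (by omega)
    rw [show m - 2 + 2 = m by omega, show m - 2 + 1 = m - 1 by omega] at e0
    have e1 := h.mid (by omega)
    have e2 := h.mid_succ (by omega)
    rw [show m + 3 - 1 = m + 2 by omega]
    generalize u (m - 2) = v at *
    generalize u (m - 1) = z at *
    generalize u m = x at *
    -- the estimate `a > 3 b + 1` enters here, as `b ≤ (a - b - 1) / 2`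
    have hz : -(1.5 * (a - b - 1)) ≤ a * (z - 1) := by nlinarith
    have hz' : b * -(1.5 * (a - b - 1)) ≤ b * (a * (z - 1)) := mul_le_mul_of_nonneg_left hz hb
    have hx' : 0 ≤ (a ^ 2 - b) * (x - 1) := mul_nonneg (by nlinarith) (by linarith)
    have e3 : u (m + 2) - 1 = -(a - 1) * (a - b - 1) + (a ^ 2 - b) * (x - 1)
        + b * (a * (z - 1)) := by
      rw [e2, e1]; ring
    rw [e3]
    nlinarith

/-- For `a` below the window no orbit is admissible: for `a ≤ 3 / 2` the first iterate
after the lowest point, and for larger `a` the twelfth, would already be above the border. -/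
theorem IsCyclicOrbit.not_admissible (h : IsCyclicOrbit a b (m + n) (iotaSign σ m n) u)
    (hm : 60 ≤ m) (hn : n = 2 ∨ n = 3) (hb : 0 ≤ b) (hb' : b ≤ 1 / 1000)
    (hab : 1 + 3 * b < a) (ha : a < 2 - 1 / 50) :
    ¬ ∀ k < m + n, 0 ≤ ((iotaSign σ m n k : ℤ) : ℝ) * (u (k + 1) - 1) := by
  intro hadm
  have hn2 : 2 ≤ n := by omega
  have hx := fun k hk => abs_le.1 (h.abs_sub_one_le_one (by omega) hb (by linarith) k hk)
  have ht := hadm (m + n - 1) (by omega)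
  rw [iotaSign, if_neg (by omega), if_pos rfl, show m + n - 1 + 1 = m + n by omega,
    h.wrap_zero] at ht
  have e1 := h.last (by omega) hn2
  have e2 := h.two (by omega)
  set t := ((σ : ℤ) : ℝ) * (u 0 - 1) with htdef
  have hu0 : |u 0 - 1| = t := by
    rw [← abs_of_nonneg ht, htdef, abs_mul, abs_sign, one_mul]
  have hu0' : u 0 - 1 ≤ t := hu0 ▸ le_abs_self _
  rw [mul_right_comm, ← htdef] at e1
  rcases le_or_gt a (3 / 2) with ha' | ha'
  · have hw := h.prev_lower_bound hm hn hb hb' hab ha' hadm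
    have h3 := le_one_of_admissible (m := m) (n := n) hadm (k := 3) (by omega) (by omega)
    have e3 := h.left (k := 1) le_rfl (by omega)
    norm_num at e3
    generalize u (m + n - 1) = w at *
    have e4 : u 3 - 1 = (a + 1) * (a - b - 1) - (a ^ 2 + b) * (u 1 - 1)
        - a * b * (u 0 - 1) := by rw [e3, e2]; ring
    have hbw : b * -(0.51 * (a - b - 1)) ≤ b * (w - 1) := mul_le_mul_of_nonneg_left hw hb
    have hx0 : u 1 - 1 ≤ (1 + 0.51 * b) * (a - b - 1) - a * t := by rw [e1]; linarith
    have h5 := mul_le_mul_of_nonneg_left hx0 (show 0 ≤ a ^ 2 + b by positivity)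
    have hab0 : 0 ≤ a * b := mul_nonneg (by linarith) hb
    have h6 := mul_le_mul_of_nonneg_left hu0' hab0
    have h7 : 0 ≤ (a ^ 2 + b - b) * (a * t) :=
      mul_nonneg (by nlinarith) (mul_nonneg (by linarith) ht)
    have h8 : 0 < (a + 1 - (a ^ 2 + b) * (1 + 0.51 * b)) * (a - b - 1) := by
      refine mul_pos ?_ (by linarith)
      have hb1 : (a ^ 2 + b) * (1 + 0.51 * b) ≤ (a ^ 2 + b) * 1.001 :=
        mul_le_mul_of_nonneg_left (by linarith) (by positivity)
      nlinarith
    nlinarith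
  · have hw := hx (m + n - 1) (by omega)
    have h2 : 0.038 ≤ u 2 := by
      have : u 2 = a * (2 - a) + a * b * u (m + n - 1) - b - b * (u 0 - 1) + a ^ 2 * t := by
        rw [e2, e1]; ring
      rw [this]
      have f1 : 0 ≤ a * b * u (m + n - 1) :=
        mul_nonneg (mul_nonneg (by linarith) hb) (by linarith)
      have f2 := mul_le_mul_of_nonneg_left hu0' hb
      have f3 : 0 ≤ (a ^ 2 - b) * t := mul_nonneg (by nlinarith) ht
      nlinarith
    have grow : ∀ j ≤ 12, 0.038 * 1.4 ^ j ≤ u (2 + j) := by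
      intro j
      induction j with
      | zero => intro _; simpa using h2
      | succ j ih =>
        intro hj
        have i1 := ih (by omega)
        have i2 : (1 : ℝ) ≤ 1.4 ^ j := one_le_pow₀ (by norm_num)
        have i3 := h.left (k := j + 1) (by omega) (by omega)
        rw [show j + 1 + 1 = 2 + j by omega, show j + 1 + 2 = 2 + (j + 1) by omega] at i3
        have i4 := hx (j + 1) (by omega)
        have i5 : b * u (j + 1) ≤ 0.002 := by nlinarith
        rw [pow_succ, i3]
        nlinarith
    have g := grow 12 le_rfl
    have := le_one_of_admissible (m := m) (n := n) hadm (k := 14) (by omega) (by omega)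
    norm_num at g
    linarith

end Small

/-! ### The border collision curves -/

/-- The height `σ x_{-1}` over the border of the formal `ι_{σ,m,n}`-periodic orbit at the place of
the symbol `σ`: the one admissibility condition that can fail close to `(a, b) = (2, 0)`. -/
noncomputable def borderHeight (a b : ℝ) (σ : ℤˣ) (m n : ℕ) : ℝ :=
  ((σ : ℤ) : ℝ) * (periodicPoint a b (iota σ m n)).2

/-- The sequence of the formal `ι_{σ,m,n}`-periodic orbit. -/
noncomputable def iotaSeq (a b : ℝ) (σ : ℤˣ) (m n : ℕ) : ℕ → ℝ :=
  orbitSeq a b (iota σ m n) (periodicPoint a b (iota σ m n))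

section

variable {a b a' b' : ℝ} {σ : ℤˣ} {m n : ℕ}

theorem borderHeight_eq : borderHeight a b σ m n = ((σ : ℤ) : ℝ) * (iotaSeq a b σ m n 0 - 1) := by
  simp [borderHeight, iotaSeq, orbitSeq]

theorem borderHeight_eq_zero_iff : borderHeight a b σ m n = 0 ↔ iotaSeq a b σ m n 0 = 1 := by
  have : ((σ : ℤ) : ℝ) ≠ 0 := by
    intro h
    have := abs_sign σ
    rw [h] at this
    simp at this
  rw [borderHeight_eq, mul_eq_zero, or_iff_right this, sub_eq_zero]

theorem isFormalPeriodic_iota_iff (hm : 2 ≤ m) (hn : 2 ≤ n) (hab : 1 + |b| < a) {θ : ℝ × ℝ} :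
    IsFormalPeriodic a b (iota σ m n) θ ↔ θ = periodicPoint a b (iota σ m n) :=
  isFormalPeriodic_iff (by rw [length_iota hm hn]; omega) hab

theorem isCyclicOrbit_iotaSeq (hm : 2 ≤ m) (hn : 2 ≤ n) (hab : 1 + |b| < a) :
    IsCyclicOrbit a b (m + n) (iotaSign σ m n) (iotaSeq a b σ m n) :=
  ((isFormalPeriodic_iota_iff hm hn hab).2 rfl).isCyclicOrbit_iota hm hn

theorem isWindowOrbit_iotaSeq (hm : 60 ≤ m) (hn : n = 2 ∨ n = 3)
    (ha : a ∈ Set.Icc (2 - 1 / 50 : ℝ) (2 + 1 / 50)) (hb : |b| ≤ 1 / 1000) :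
    IsWindowOrbit a b σ m n (iotaSeq a b σ m n) where
  toIsCyclicOrbit := isCyclicOrbit_iotaSeq (by omega) (by omega) (by linarith [ha.1])
  m_large := hm
  n_mem := hn
  a_mem := ha
  b_mem := hb

/-- On the border the last symbol does not matter. -/
theorem periodicPoint_eq_of_borderHeight_eq_zero (hm : 2 ≤ m) (hn : 2 ≤ n) (hab : 1 + |b| < a)
    (h : borderHeight a b σ m n = 0) (τ : ℤˣ) :
    periodicPoint a b (iota τ m n) = periodicPoint a b (iota σ m n) := by
  symm
  rw [← isFormalPeriodic_iota_iff hm hn hab]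
  have hp : IsFormalPeriodic a b (iota σ m n) (periodicPoint a b (iota σ m n)) :=
    (isFormalPeriodic_iota_iff hm hn hab).2 rfl
  have h0 : (periodicPoint a b (iota σ m n)).2 = 0 := by
    have := borderHeight_eq_zero_iff.1 h
    simpa [iotaSeq, orbitSeq] using this
  generalize periodicPoint a b (iota σ m n) = θ at *
  unfold IsFormalPeriodic formalIterate at hp ⊢
  simp only [iota, List.foldl_append, List.foldl_cons, List.foldl_nil] at hp ⊢
  refine Eq.trans ?_ hp
  generalize List.foldl _ _ _ = p at *
  have h1 : p.1 = 0 := (congrArg Prod.snd hp).trans h0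
  simp [branch, h1]

theorem le_borderHeight_sub (hm : 60 ≤ m) (hn : n = 2 ∨ n = 3)
    (ha : a ∈ Set.Icc (2 - 1 / 50 : ℝ) (2 + 1 / 50))
    (ha' : a' ∈ Set.Icc (2 - 1 / 50 : ℝ) (2 + 1 / 50)) (hb : |b| ≤ 1 / 1000) (haa : a ≤ a') :
    0.4 * (a' - a) ≤ borderHeight a' b σ m n - borderHeight a b σ m n := by
  have h := (isWindowOrbit_iotaSeq (σ := σ) hm hn ha hb).abs_height_diff_le
    (isWindowOrbit_iotaSeq (σ := σ) hm hn ha' hb)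
  rw [← borderHeight_eq, ← borderHeight_eq, sub_self, abs_zero, zero_mul, add_zero, add_zero,
    abs_of_nonneg (sub_nonneg.2 haa)] at h
  have h1 := (abs_le.1 h).1
  obtain ⟨h2, h3⟩ := ha'
  by_contra hc
  nlinarith

theorem borderHeight_lt_iff (hm : 60 ≤ m) (hn : n = 2 ∨ n = 3)
    (ha : a ∈ Set.Icc (2 - 1 / 50 : ℝ) (2 + 1 / 50))
    (ha' : a' ∈ Set.Icc (2 - 1 / 50 : ℝ) (2 + 1 / 50)) (hb : |b| ≤ 1 / 1000) :
    borderHeight a b σ m n < borderHeight a' b σ m n ↔ a < a' := by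
  constructor
  · intro h
    by_contra hc
    have := le_borderHeight_sub (σ := σ) hm hn ha' ha hb (not_lt.1 hc)
    linarith
  · intro h
    have := le_borderHeight_sub (σ := σ) hm hn ha ha' hb h.le
    linarith

theorem analyticAt_borderHeight (hm : 2 ≤ m) (hn : 2 ≤ n) {p : ℝ × ℝ} (hp : 1 + |p.1| < p.2) :
    AnalyticAt ℝ (fun q : ℝ × ℝ => borderHeight q.2 q.1 σ m n) p :=
  analyticAt_const.mul (analyticAt_periodicPoint_snd (by rw [length_iota hm hn]; omega) hp)

theorem exists_borderHeight_eq_zero (hm : 60 ≤ m) (hn : n = 2 ∨ n = 3) (hb : |b| ≤ 1 / 1000)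
    (σ : ℤˣ) :
    ∃ a ∈ Set.Ioo (2 - 1 / 50 : ℝ) (2 + 1 / 50), borderHeight a b σ m n = 0 := by
  have hc : ContinuousOn (fun a => borderHeight a b σ m n)
      (Set.Icc (2 - 1 / 50 : ℝ) (2 + 1 / 50)) := by
    intro a ha
    have h1 : ContinuousAt (fun q : ℝ × ℝ => borderHeight q.2 q.1 σ m n) (b, a) :=
      (analyticAt_borderHeight (by omega) (by omega) (by
        have := ha.1
        simp only
        linarith)).continuousAt
    have h2 : ContinuousAt (fun a : ℝ => (b, a)) a := by fun_prop
    exact (ContinuousAt.comp (f := fun a : ℝ => (b, a)) h1 h2).continuousWithinAt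
  have e : ∀ a ∈ Set.Icc (2 - 1 / 50 : ℝ) (2 + 1 / 50),
      |a * borderHeight a b σ m n - (a - 2)| ≤ 0.0051 := fun a ha => by
    rw [borderHeight_eq]
    exact (isWindowOrbit_iotaSeq hm hn ha hb).abs_height_sub_le
  have e1 := abs_le.1 (e (2 - 1 / 50) (by constructor <;> norm_num))
  have e2 := abs_le.1 (e (2 + 1 / 50) (by constructor <;> norm_num))
  exact intermediate_value_Ioo (by norm_num) hc ⟨by linarith, by linarith⟩

/-- The border collision curve `a = l_{m,n}(b)`: the parameter near `a = 2` at which the orbit of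
the formal periodic point meets the border. -/
noncomputable def borderCurve (m n : ℕ) (b : ℝ) : ℝ :=
  Classical.epsilon fun a =>
    a ∈ Set.Ioo (2 - 1 / 50 : ℝ) (2 + 1 / 50) ∧ borderHeight a b 1 m n = 0

theorem borderCurve_mem (hm : 60 ≤ m) (hn : n = 2 ∨ n = 3) (hb : |b| ≤ 1 / 1000) :
    borderCurve m n b ∈ Set.Ioo (2 - 1 / 50 : ℝ) (2 + 1 / 50) :=
  (Classical.epsilon_spec (exists_borderHeight_eq_zero hm hn hb 1)).1

theorem borderHeight_borderCurve (hm : 60 ≤ m) (hn : n = 2 ∨ n = 3) (hb : |b| ≤ 1 / 1000)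
    (σ : ℤˣ) : borderHeight (borderCurve m n b) b σ m n = 0 := by
  have h1 : borderHeight (borderCurve m n b) b 1 m n = 0 :=
    (Classical.epsilon_spec (exists_borderHeight_eq_zero hm hn hb 1)).2
  have hl := (borderCurve_mem hm hn hb).1
  have := periodicPoint_eq_of_borderHeight_eq_zero (by omega) (by omega) (by linarith) h1 σ
  rw [borderHeight_eq_zero_iff] at h1 ⊢
  simp only [iotaSeq, orbitSeq] at h1 ⊢
  rwa [this]

theorem borderHeight_nonneg_iff (hm : 60 ≤ m) (hn : n = 2 ∨ n = 3)
    (ha : a ∈ Set.Icc (2 - 1 / 50 : ℝ) (2 + 1 / 50)) (hb : |b| ≤ 1 / 1000) :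
    0 ≤ borderHeight a b σ m n ↔ borderCurve m n b ≤ a := by
  have hl := Set.Ioo_subset_Icc_self (borderCurve_mem hm hn hb)
  rw [← not_lt, ← not_lt, ← borderHeight_borderCurve hm hn hb σ,
    borderHeight_lt_iff hm hn ha hl hb]

theorem borderHeight_eq_zero_iff_eq (hm : 60 ≤ m) (hn : n = 2 ∨ n = 3)
    (ha : a ∈ Set.Icc (2 - 1 / 50 : ℝ) (2 + 1 / 50)) (hb : |b| ≤ 1 / 1000) :
    borderHeight a b σ m n = 0 ↔ a = borderCurve m n b := by
  have hl := Set.Ioo_subset_Icc_self (borderCurve_mem hm hn hb)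
  constructor
  · intro h
    have h0 := borderHeight_borderCurve hm hn hb σ
    have h1 := borderHeight_lt_iff (σ := σ) hm hn ha hl hb
    have h2 := borderHeight_lt_iff (σ := σ) hm hn hl ha hb
    rw [h, h0] at h1 h2
    simp only [lt_self_iff_false, false_iff, not_lt] at h1 h2
    exact le_antisymm h2 h1
  · rintro rfl
    exact borderHeight_borderCurve hm hn hb σ

/-! ### Slopes and analyticity of the curves -/

theorem abs_borderCurve_sub_le (hm : 60 ≤ m) (hn : n = 2 ∨ n = 3) (hb : |b| ≤ 1 / 1000)
    (hb' : |b'| ≤ 1 / 1000) :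
    |-(borderCurve m n b' - borderCurve m n b)
      + (b' - b) * (iotaSeq (borderCurve m n b) b 1 m n (m + n - 1) - 1)|
      ≤ 0.1 * (|borderCurve m n b' - borderCurve m n b| + |b' - b|) := by
  have h := (isWindowOrbit_iotaSeq (σ := 1) hm hn
    (Set.Ioo_subset_Icc_self (borderCurve_mem hm hn hb)) hb).abs_height_diff_le
    (isWindowOrbit_iotaSeq hm hn (Set.Ioo_subset_Icc_self (borderCurve_mem hm hn hb')) hb')
  rw [← borderHeight_eq, ← borderHeight_eq, borderHeight_borderCurve hm hn hb,
    borderHeight_borderCurve hm hn hb'] at h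
  simpa using h

/-- The curve for `n = 2` has slope close to `1 / 2`. -/
theorem le_borderCurve_two_sub (hm : 60 ≤ m) (hb : |b| ≤ 1 / 1000) (hb' : |b'| ≤ 1 / 1000)
    (hbb : b ≤ b') : 0.3 * (b' - b) ≤ borderCurve m 2 b' - borderCurve m 2 b := by
  have h := abs_borderCurve_sub_le hm (.inl rfl) hb hb'
  have hw := (isWindowOrbit_iotaSeq (σ := 1) hm (.inl rfl)
    (Set.Ioo_subset_Icc_self (borderCurve_mem hm (.inl rfl) hb)) hb).prev_mem_of_two
  rw [show m + 2 - 1 = m + 1 by omega, abs_of_nonneg (sub_nonneg.2 hbb)] at h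
  generalize iotaSeq _ _ _ _ _ _ = w at *
  generalize borderCurve m 2 b' - borderCurve m 2 b = d at *
  have h1 := (abs_le.1 h).2
  have h2 : (b' - b) * 0.48 ≤ (b' - b) * (w - 1) :=
    mul_le_mul_of_nonneg_left (by linarith [hw.1]) (by linarith)
  rcases abs_cases d with ⟨h3, h4⟩ | ⟨h3, h4⟩ <;> rw [h3] at h1 <;> linarith

/-- The curve for `n = 3` has slope close to `-1 / 2`. -/
theorem borderCurve_three_sub_le (hm : 60 ≤ m) (hb : |b| ≤ 1 / 1000) (hb' : |b'| ≤ 1 / 1000)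
    (hbb : b ≤ b') : borderCurve m 3 b' - borderCurve m 3 b ≤ -(0.3 * (b' - b)) := by
  have h := abs_borderCurve_sub_le hm (.inr rfl) hb hb'
  have hw := (isWindowOrbit_iotaSeq (σ := 1) hm (.inr rfl)
    (Set.Ioo_subset_Icc_self (borderCurve_mem hm (.inr rfl) hb)) hb).prev_mem_of_three
  rw [show m + 3 - 1 = m + 2 by omega, abs_of_nonneg (sub_nonneg.2 hbb)] at h
  generalize iotaSeq _ _ _ _ _ _ = w at *
  generalize borderCurve m 3 b' - borderCurve m 3 b = d at *
  have h1 := (abs_le.1 h).1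
  have h2 : (b' - b) * (w - 1) ≤ (b' - b) * (-0.48) :=
    mul_le_mul_of_nonneg_left (by linarith [hw.2]) (by linarith)
  rcases abs_cases d with ⟨h3, h4⟩ | ⟨h3, h4⟩ <;> rw [h3] at h1 <;> linarith

/-- A lower bound for the increments on the right bounds the derivative from below. -/
theorem le_of_hasDerivAt_of_le_sub {f : ℝ → ℝ} {x d c : ℝ} (hf : HasDerivAt f d x)
    (h : ∀ᶠ y in 𝓝[>] x, c * (y - x) ≤ f y - f x) : c ≤ d := by
  have h1 := hf.tendsto_slope.mono_left (nhdsGT_le_nhdsNE x)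
  refine ge_of_tendsto h1 ?_
  filter_upwards [h, self_mem_nhdsWithin] with y hy hxy
  rw [slope_def_field, le_div_iff₀ (sub_pos.2 hxy)]
  exact hy

theorem analyticAt_borderCurve (hm : 60 ≤ m) (hn : n = 2 ∨ n = 3) (hb : |b| < 1 / 1000) :
    AnalyticAt ℝ (borderCurve m n) b := by
  have hl := borderCurve_mem hm hn hb.le
  have hl' := Set.Ioo_subset_Icc_self hl
  set p : ℝ × ℝ := (b, borderCurve m n b) with hp
  set f : ℝ × ℝ → ℝ := fun q => borderHeight q.2 q.1 1 m n with hf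
  have han : AnalyticAt ℝ f p :=
    analyticAt_borderHeight (by omega) (by omega) (by simp only [hp]; linarith [hl.1])
  have cdf : ContDiffAt ℝ ω f p := han.contDiffAt
  have hd : HasDerivAt (fun a => f (b, a)) (fderiv ℝ f p (0, 1)) (borderCurve m n b) := by
    have h1 : HasDerivAt (fun a : ℝ => (b, a)) ((0 : ℝ), (1 : ℝ)) (borderCurve m n b) :=
      (hasDerivAt_const _ _).prodMk (hasDerivAt_id _)
    exact han.differentiableAt.hasFDerivAt.comp_hasDerivAt (borderCurve m n b) h1
  have hpos : 0.4 ≤ fderiv ℝ f p (0, 1) := by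
    refine le_of_hasDerivAt_of_le_sub hd ?_
    filter_upwards [mem_nhdsWithin_of_mem_nhds (Ioo_mem_nhds hl.1 hl.2), self_mem_nhdsWithin]
      with a ha hla
    exact le_borderHeight_sub hm hn hl' (Set.Ioo_subset_Icc_self ha) hb.le (le_of_lt hla)
  have hinv : (fderiv ℝ f p ∘L .inr ℝ ℝ ℝ).IsInvertible := by
    refine ⟨ContinuousLinearEquiv.unitsEquivAut ℝ
      (Units.mk0 (fderiv ℝ f p (0, 1)) (by linarith)), ?_⟩
    ext
    simp
  have hω : (ω : WithTop ℕ∞) ≠ 0 := by simp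
  have hψ := cdf.contDiffAt_implicitFunction hω hinv
  refine hψ.analyticAt.congr ?_
  have hmem : ∀ᶠ x in 𝓝 b, cdf.implicitFunction hω hinv x
      ∈ Set.Ioo (2 - 1 / 50 : ℝ) (2 + 1 / 50) := by
    refine hψ.continuousAt.eventually ?_
    rw [cdf.implicitFunction_apply_self hω hinv]
    exact Ioo_mem_nhds hl.1 hl.2
  have hsmall : ∀ᶠ x in 𝓝 b, |x| < 1 / 1000 :=
    continuous_abs.continuousAt.eventually (gt_mem_nhds hb)
  filter_upwards [cdf.eventually_apply_implicitFunction hω hinv, hmem, hsmall] with x h1 h2 h3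
  rw [← borderHeight_eq_zero_iff_eq (σ := 1) hm hn (Set.Ioo_subset_Icc_self h2) h3.le]
  exact h1.trans (borderHeight_borderCurve hm hn hb.le 1)

/-! ### Admissibility and bifurcation -/

theorem isAdmissible_periodicPoint_iff_sign (hm : 2 ≤ m) (hn : 2 ≤ n) :
    IsAdmissible a b (iota σ m n) (periodicPoint a b (iota σ m n)) ↔
      ∀ k < m + n, 0 ≤ ((iotaSign σ m n k : ℤ) : ℝ) * (iotaSeq a b σ m n (k + 1) - 1) :=
  isAdmissible_iff hm hn

theorem isAdmissible_periodicPoint_iff (hm : 60 ≤ m) (hn : n = 2 ∨ n = 3) (hb : 0 ≤ b)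
    (hb' : b ≤ 1 / 1000) (hab : 1 + 3 * b < a) :
    IsAdmissible a b (iota σ m n) (periodicPoint a b (iota σ m n)) ↔ borderCurve m n b ≤ a := by
  have hbabs : |b| ≤ 1 / 1000 := by rwa [abs_of_nonneg hb]
  have hl := borderCurve_mem hm hn hbabs
  have hc : IsCyclicOrbit a b (m + n) (iotaSign σ m n) (iotaSeq a b σ m n) :=
    isCyclicOrbit_iotaSeq (by omega) (by omega) (by rw [abs_of_nonneg hb]; linarith)
  rw [isAdmissible_periodicPoint_iff_sign (by omega) (by omega)]
  rcases lt_or_ge a (2 - 1 / 50) with h1 | h1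
  · exact iff_of_false (hc.not_admissible hm hn hb hb' hab h1) (by linarith [hl.1])
  rcases lt_or_ge (2 + 1 / 50) a with h2 | h2
  · exact iff_of_true (fun k hk => (hc.sign_mul_pos hb (by linarith) hk).le) (by linarith [hl.2])
  rw [← borderHeight_nonneg_iff (σ := σ) hm hn ⟨h1, h2⟩ hbabs, borderHeight_eq]
  have hw := isWindowOrbit_iotaSeq (σ := σ) hm hn ⟨h1, h2⟩ hbabs
  have hlast : ((iotaSign σ m n (m + n - 1) : ℤ) : ℝ) * (iotaSeq a b σ m n (m + n - 1 + 1) - 1)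
      = ((σ : ℤ) : ℝ) * (iotaSeq a b σ m n 0 - 1) := by
    rw [iotaSign, if_neg (by omega), if_pos rfl, show m + n - 1 + 1 = m + n by omega,
      hc.wrap_zero]
  constructor
  · intro h
    rw [← hlast]
    exact h _ (by omega)
  · intro h k hk
    rcases Nat.lt_or_ge (k + 1) (m + n) with h3 | h3
    · exact (hw.sign_mul_pos h3).le
    · obtain rfl : k = m + n - 1 := by omega
      rwa [hlast]

theorem eq_borderCurve_of_iotaSeq_eq_one (hm : 60 ≤ m) (hn : n = 2 ∨ n = 3) (hb : 0 ≤ b)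
    (hb' : b ≤ 1 / 1000) (hla : borderCurve m n b ≤ a) {k : ℕ} (hk : k < m + n)
    (h : iotaSeq a b σ m n (k + 1) = 1) : a = borderCurve m n b := by
  have hbabs : |b| ≤ 1 / 1000 := by rwa [abs_of_nonneg hb]
  have hl := borderCurve_mem hm hn hbabs
  have hc : IsCyclicOrbit a b (m + n) (iotaSign σ m n) (iotaSeq a b σ m n) :=
    isCyclicOrbit_iotaSeq (by omega) (by omega) (by linarith [hl.1])
  rcases lt_or_ge (2 + 1 / 50) a with h2 | h2
  · have := hc.sign_mul_pos hb (by linarith) hk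
    rw [h] at this
    simp at this
  have ha : a ∈ Set.Icc (2 - 1 / 50 : ℝ) (2 + 1 / 50) := ⟨by linarith [hl.1], h2⟩
  have hw := isWindowOrbit_iotaSeq (σ := σ) hm hn ha hbabs
  rcases Nat.lt_or_ge (k + 1) (m + n) with h3 | h3
  · have := hw.sign_mul_pos h3
    rw [h] at this
    simp at this
  · rw [show k + 1 = m + n by omega, hc.wrap_zero] at h
    exact (borderHeight_eq_zero_iff_eq hm hn ha hbabs).1 (borderHeight_eq_zero_iff.2 h)

theorem lozi_iterate_fst_eq (hm : 2 ≤ m) (hn : 2 ≤ n)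
    (h : IsAdmissible a b (iota σ m n) (periodicPoint a b (iota σ m n))) {k : ℕ}
    (hk : k ≤ m + n) :
    ((lozi a b)^[k] (periodicPoint a b (iota σ m n))).1 = iotaSeq a b σ m n (k + 1) - 1 := by
  rw [← h.formalIterate_take_eq k (by rwa [length_iota hm hn])]
  simp [iotaSeq, orbitSeq]

theorem admissibleAt_iff (hm : 60 ≤ m) (hn : n = 2 ∨ n = 3) (hb : 0 ≤ b)
    (hb' : b ≤ 1 / 1000) (hab : 1 + 3 * b < a) :
    AdmissibleAt a b σ m n ↔ borderCurve m n b ≤ a := by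
  rw [← isAdmissible_periodicPoint_iff (σ := σ) hm hn hb hb' hab, AdmissibleAt]
  simp only [isFormalPeriodic_iota_iff (σ := σ) (show 2 ≤ m by omega) (show 2 ≤ n by omega)
    (show 1 + |b| < a by rw [abs_of_nonneg hb]; linarith), exists_eq_left]

theorem lozi_iterate_fst_eq_zero (hm : 60 ≤ m) (hn : n = 2 ∨ n = 3) (hb : 0 ≤ b)
    (hb' : b ≤ 1 / 1000) (hab : 1 + 3 * b < a) (ha : a = borderCurve m n b) :
    ((lozi a b)^[m + n - 1] (periodicPoint a b (iota σ m n))).1 = 0 := by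
  have hbabs : |b| ≤ 1 / 1000 := by rwa [abs_of_nonneg hb]
  have h0 : borderHeight a b σ m n = 0 := ha ▸ borderHeight_borderCurve hm hn hbabs σ
  have hc : IsCyclicOrbit a b (m + n) (iotaSign σ m n) (iotaSeq a b σ m n) :=
    isCyclicOrbit_iotaSeq (by omega) (by omega) (by rw [abs_of_nonneg hb]; linarith)
  rw [lozi_iterate_fst_eq (by omega) (by omega)
    ((isAdmissible_periodicPoint_iff hm hn hb hb' hab).2 ha.ge) (by omega),
    show m + n - 1 + 1 = m + n by omega, hc.wrap_zero, borderHeight_eq_zero_iff.1 h0, sub_self]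

theorem borderCollisionAt_iff (hm : 60 ≤ m) (hn : n = 2 ∨ n = 3) (hb : 0 ≤ b)
    (hb' : b ≤ 1 / 1000) (hab : 1 + 3 * b < a) :
    BorderCollisionAt a b (iota σ m n) ↔ a = borderCurve m n b := by
  have hab' : 1 + |b| < a := by rw [abs_of_nonneg hb]; linarith
  constructor
  · rintro ⟨θ, hp, hadm, k, hk, hz⟩
    obtain rfl := (isFormalPeriodic_iota_iff (by omega) (by omega) hab').1 hp
    rw [length_iota (by omega) (by omega)] at hk
    rw [lozi_iterate_fst_eq (by omega) (by omega) hadm hk.le] at hz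
    exact eq_borderCurve_of_iotaSeq_eq_one hm hn hb hb'
      ((isAdmissible_periodicPoint_iff hm hn hb hb' hab).1 hadm) hk (by linarith)
  · intro ha
    refine ⟨_, (isFormalPeriodic_iota_iff (by omega) (by omega) hab').2 rfl,
      (isAdmissible_periodicPoint_iff hm hn hb hb' hab).2 ha.ge, m + n - 1, ?_,
      lozi_iterate_fst_eq_zero hm hn hb hb' hab ha⟩
    rw [length_iota (by omega) (by omega)]
    omega

theorem bifurcationParameter_iff (hm : 60 ≤ m) (hn : n = 2 ∨ n = 3) (hb : 0 ≤ b)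
    (hb' : b ≤ 1 / 1000) (hab : 1 + 3 * b < a) :
    BifurcationParameter a b m n ↔ a = borderCurve m n b := by
  have hab' : 1 + |b| < a := by rw [abs_of_nonneg hb]; linarith
  constructor
  · rintro ⟨θ, h, hz⟩
    refine (borderCollisionAt_iff (σ := 1) hm hn hb hb' hab).1
      ⟨θ, (h 1).1, (h 1).2, m + n - 1, ?_, hz⟩
    rw [length_iota (by omega) (by omega)]
    omega
  · intro ha
    refine ⟨periodicPoint a b (iota 1 m n), fun σ => ?_,
      lozi_iterate_fst_eq_zero hm hn hb hb' hab ha⟩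
    have h0 : borderHeight a b 1 m n = 0 :=
      ha ▸ borderHeight_borderCurve hm hn (by rwa [abs_of_nonneg hb]) 1
    rw [← periodicPoint_eq_of_borderHeight_eq_zero (by omega) (by omega) hab' h0 σ]
    exact ⟨(isFormalPeriodic_iota_iff (by omega) (by omega) hab').2 rfl,
      (isAdmissible_periodicPoint_iff hm hn hb hb' hab).2 ha.ge⟩

/-! ### The two curves on the line `b = 0` -/

theorem iotaSeq_borderCurve_zero (hm : 60 ≤ m) (hn : n = 2 ∨ n = 3) :
    iotaSeq (borderCurve m n 0) 0 1 m n 0 = 1 ∧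
      iotaSeq (borderCurve m n 0) 0 1 m n 1 = borderCurve m n 0 := by
  have hb : |(0 : ℝ)| ≤ 1 / 1000 := by norm_num
  have h0 := borderHeight_eq_zero_iff.1 (borderHeight_borderCurve hm hn hb 1)
  have hw := isWindowOrbit_iotaSeq (σ := 1) hm hn
    (Set.Ioo_subset_Icc_self (borderCurve_mem hm hn hb)) hb
  refine ⟨h0, ?_⟩
  rw [hw.last (by omega) (by omega), h0]
  ring

/-- In the tent family the bifurcation takes place for `a ≤ 2`. -/
theorem borderCurve_zero_le_two (hm : 60 ≤ m) (hn : n = 2 ∨ n = 3) : borderCurve m n 0 ≤ 2 := by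
  have hb : |(0 : ℝ)| ≤ 1 / 1000 := by norm_num
  have hl := borderCurve_mem hm hn hb
  have hw := isWindowOrbit_iotaSeq (σ := 1) hm hn (Set.Ioo_subset_Icc_self hl) hb
  have := abs_le.1 (hw.abs_sub_one_le_one (by omega) le_rfl (by linarith [hl.1]) 1 (by omega))
  rw [(iotaSeq_borderCurve_zero hm hn).2] at this
  linarith

/-- In the tent family the bifurcation takes place exponentially close to `a = 2`, since the orbit
stays close to the fixed point `x = -1` for `m - 2` steps. -/
theorem two_sub_le_borderCurve_zero (hm : 60 ≤ m) (hn : n = 2 ∨ n = 3) :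
    2 - 2.01 / 1.9 ^ (m - 2) ≤ borderCurve m n 0 := by
  have hb : |(0 : ℝ)| ≤ 1 / 1000 := by norm_num
  have hl := borderCurve_mem hm hn hb
  have hw := isWindowOrbit_iotaSeq (σ := 1) hm hn (Set.Ioo_subset_Icc_self hl) hb
  have h1 := (iotaSeq_borderCurve_zero hm hn).2
  have h2 := hw.two (by omega)
  have key := le_of_backward_expansion (ρ := 1.9) (η := 0) (by norm_num) le_rfl
    (y := fun k => |iotaSeq (borderCurve m n 0) 0 1 m n k|) (M := 2.01) (m - 2) 2
    (fun k hk hk' => by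
      have e := hw.left (k := k - 1) (by omega) (by omega)
      rw [show k - 1 + 2 = k + 1 by omega, show k - 1 + 1 = k by omega, zero_mul, sub_zero] at e
      rw [add_zero, e, abs_mul, abs_of_pos (by linarith [hl.1] : 0 < borderCurve m n 0)]
      exact mul_le_mul_of_nonneg_right (by linarith [hl.1]) (abs_nonneg _))
    (hw.abs_le (by omega))
  rw [zero_div, add_zero, h2, h1, zero_mul, sub_zero] at key
  have h3 := (le_abs_self _).trans key
  have h4 := borderCurve_zero_le_two hm hn
  nlinarith [hl.1]

/-- In the tent family the orbits for `n = 2` are created before those for `n = 3`. -/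
theorem borderCurve_two_zero_lt (hm : 60 ≤ m) : borderCurve m 2 0 < borderCurve m 3 0 := by
  have hb : |(0 : ℝ)| ≤ 1 / 1000 := by norm_num
  have hl := borderCurve_mem hm (.inl rfl) hb
  have hl' := Set.Ioo_subset_Icc_self hl
  have hw := isWindowOrbit_iotaSeq (σ := 1) hm (.inl rfl) hl' hb
  have hw' := isWindowOrbit_iotaSeq (n := 3) (σ := 1) hm (.inr rfl) hl' hb
  obtain ⟨h0, h1⟩ := iotaSeq_borderCurve_zero hm (.inl rfl)
  rw [← not_le, ← borderHeight_nonneg_iff (σ := 1) hm (.inr rfl) hl' hb, borderHeight_eq]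
  set a := borderCurve m 2 0
  set u := iotaSeq a 0 1 m 2
  set u' := iotaSeq a 0 1 m 3
  -- the orbit for `n = 3` departs from the bifurcating orbit for `n = 2` as the powers of `a`
  set t := u' 0 - 1 with ht
  have e1 := hw'.last (by omega) (by omega)
  have d1 : u' 1 = u 1 - a * t := by rw [e1, h1]; push_cast; ring
  have d : ∀ k, k + 2 ≤ m → u' (k + 2) = u (k + 2) + a ^ (k + 2) * t := by
    intro k
    induction k with
    | zero =>
      intro _
      rw [hw'.two (by omega), hw.two (by omega), d1]
      ring
    | succ k ih =>
      intro hk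
      rw [hw'.left (k := k + 1) (by omega) hk, hw.left (k := k + 1) (by omega) hk,
        ih (by omega)]
      ring
  have dm := d (m - 2) (by omega)
  rw [show m - 2 + 2 = m by omega] at dm
  have hend : u (m + 2) = 1 := hw.wrap_zero.trans h0
  have d2 : u' (m + 2) = 1 + a ^ (m + 2) * t := by
    rw [← hend, hw'.mid_succ (by omega), hw.mid_succ le_rfl, hw'.mid (by omega),
      hw.mid (by omega), dm]
    ring
  have d3 : u' 0 = a * (1 + a ^ (m + 2) * t) := by
    rw [← hw'.wrap_zero, hw'.right (by omega), d2]
    ring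
  push_cast
  rw [one_mul]
  intro hc
  have hpow : 1 ≤ a ^ (m + 2) := one_le_pow₀ (by linarith [hl.1])
  have h2 : t ≤ a ^ (m + 2) * t := le_mul_of_one_le_left hc hpow
  nlinarith [hl.1]

end

end Lozi

theorem mainTheorem1 (bhat : ℝ) (hbhat : bhat ∈ Set.Ioo (0 : ℝ) 1) :
    ∃ bbar ∈ Set.Ioo (0 : ℝ) bhat, ∃ m : ℕ, 5 ≤ m ∧ ∃ l : ℕ → ℝ → ℝ,
      -- `l 2` and `l 3` are analytic curves `[0, bbar] → (√2, 4)` in the parameter space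
      (∀ n ∈ ({2, 3} : Set ℕ),
        AnalyticOnNhd ℝ (l n) (Set.Icc 0 bbar) ∧
        Set.MapsTo (l n) (Set.Icc 0 bbar) (Set.Ioo (√2) 4) ∧
        ∀ b ∈ Set.Icc 0 bbar, (l n b, b) ∈ Pnbd bbar) ∧
      -- for `n = 2, 3`: the formal periodic points exist, are unique, are admissible exactly on
      -- `a ≥ l n b`, and the border collision bifurcation happens exactly on `a = l n b`
      (∀ a b : ℝ, (a, b) ∈ Pnbd bbar → ∀ n ∈ ({2, 3} : Set ℕ),
        (∀ σ : ℤˣ,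
          (∃! θ : ℝ × ℝ, IsFormalPeriodic a b (iota σ m n) θ) ∧
          (AdmissibleAt a b σ m n ↔ l n b ≤ a) ∧
          (BorderCollisionAt a b (iota σ m n) ↔ a = l n b)) ∧
        (BifurcationParameter a b m n ↔ a = l n b)) ∧
      -- the order of the two curves reverses
      l 2 0 < l 3 0 ∧ l 3 bbar < l 2 bbar ∧
      -- the intersection of the two curves is unique and transverse
      (∃! b : ℝ, b ∈ Set.Icc 0 bbar ∧ l 2 b = l 3 b) ∧
      (∀ b ∈ Set.Icc 0 bbar, l 2 b = l 3 b → deriv (l 2) b ≠ deriv (l 3) b) ∧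
      -- on the line `b = 0` (the tent family), admissibility for `ι_{σ,m,3}` forces admissibility
      -- for `ι_{τ,m,2}`; on the line `b = bbar` this fails
      (∀ a : ℝ, (a, 0) ∈ Pnbd bbar → ∀ σ τ : ℤˣ, AdmissibleAt a 0 σ m 3 →
        AdmissibleAt a 0 τ m 2) ∧
      (∃ a : ℝ, (a, bbar) ∈ Pnbd bbar ∧
        ∀ σ : ℤˣ, AdmissibleAt a bbar σ m 3 ∧ ¬ AdmissibleAt a bbar σ m 2) := by
  obtain ⟨hbh0, -⟩ := hbhat
  obtain ⟨bbar, hbbar0, hbbar1, hbbar2⟩ :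
      ∃ bbar : ℝ, 0 < bbar ∧ bbar < bhat ∧ bbar ≤ 1 / 2000 :=
    ⟨min (bhat / 2) (1 / 2000), by positivity,
      (min_le_left _ _).trans_lt (by linarith), min_le_right _ _⟩
  -- the curves start within `0.1 * bbar` of each other and separate with speed at least `0.3`
  obtain ⟨k, hk⟩ := pow_unbounded_of_one_lt (20.1 / bbar) (show (1 : ℝ) < 1.9 by norm_num)
  obtain ⟨m, hm, hmk⟩ : ∃ m, 60 ≤ m ∧ k ≤ m - 2 := ⟨k + 60, by omega, by omega⟩
  have hpow : 2.01 / (1.9 : ℝ) ^ (m - 2) ≤ 0.1 * bbar := by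
    have h1 : (1.9 : ℝ) ^ k ≤ 1.9 ^ (m - 2) := pow_le_pow_right₀ (by norm_num) hmk
    rw [div_lt_iff₀ hbbar0] at hk
    rw [div_le_iff₀ (by positivity)]
    nlinarith
  have hn : ∀ n ∈ ({2, 3} : Set ℕ), n = 2 ∨ n = 3 := fun n h => by simpa using h
  have habs : ∀ b ∈ Set.Icc 0 bbar, |b| ≤ 1 / 1000 := fun b hb => by
    rw [abs_of_nonneg hb.1]; linarith [hb.2]
  have hsqrt : √2 < 2 - 1 / 50 := by
    rw [Real.sqrt_lt' (by norm_num)]; norm_num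
  have hpar : ∀ {a b : ℝ}, (a, b) ∈ Pnbd bbar → 0 ≤ b ∧ b ≤ 1 / 1000 ∧ 1 + 3 * b < a :=
    fun {a b} h => by
      obtain ⟨h1, h2, h3⟩ := h
      simp only at h1 h2 h3
      exact ⟨h2, by linarith, by linarith⟩
  have hmemP : ∀ n, (n = 2 ∨ n = 3) → ∀ b ∈ Set.Icc 0 bbar, (borderCurve m n b, b) ∈ Pnbd bbar :=
    fun n hn b hb => ⟨by
      have := (borderCurve_mem hm hn (habs b hb)).1
      simp only
      linarith [hb.2], hb.1, hb.2⟩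
  have h0mem : (0 : ℝ) ∈ Set.Icc 0 bbar := ⟨le_rfl, hbbar0.le⟩
  have hbmem : bbar ∈ Set.Icc 0 bbar := ⟨hbbar0.le, le_rfl⟩
  have hlt0 := borderCurve_two_zero_lt hm
  have hltb : borderCurve m 3 bbar < borderCurve m 2 bbar := by
    have h1 := le_borderCurve_two_sub hm (habs 0 h0mem) (habs bbar hbmem) hbbar0.le
    have h2 := borderCurve_three_sub_le hm (habs 0 h0mem) (habs bbar hbmem) hbbar0.le
    have h3 := two_sub_le_borderCurve_zero hm (.inl rfl)
    have h4 := borderCurve_zero_le_two hm (.inr rfl)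
    linarith
  have han : ∀ n, (n = 2 ∨ n = 3) → AnalyticOnNhd ℝ (borderCurve m n) (Set.Icc 0 bbar) :=
    fun n hn b hb => analyticAt_borderCurve hm hn (by
      rw [abs_of_nonneg hb.1]; linarith [hb.2])
  refine ⟨bbar, ⟨hbbar0, hbbar1⟩, m, by omega, borderCurve m, ?_, ?_, hlt0, hltb, ?_, ?_, ?_, ?_⟩
  · intro n hnn
    refine ⟨han n (hn n hnn), fun b hb => ?_, hmemP n (hn n hnn)⟩
    have := borderCurve_mem hm (hn n hnn) (habs b hb)
    exact ⟨hsqrt.trans this.1, this.2.trans (by norm_num)⟩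
  · intro a b hab n hnn
    obtain ⟨h1, h2, h3⟩ := hpar hab
    have hn' := hn n hnn
    refine ⟨fun σ => ⟨⟨_, (isFormalPeriodic_iota_iff (by omega) (by omega) ?_).2 rfl,
      fun θ hθ => (isFormalPeriodic_iota_iff (by omega) (by omega) ?_).1 hθ⟩,
      admissibleAt_iff hm hn' h1 h2 h3, borderCollisionAt_iff hm hn' h1 h2 h3⟩,
      bifurcationParameter_iff hm hn' h1 h2 h3⟩ <;>
    · rw [abs_of_nonneg h1]; linarith
  · have hcont : ContinuousOn (fun b => borderCurve m 2 b - borderCurve m 3 b) (Set.Icc 0 bbar) :=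
      (han 2 (.inl rfl)).continuousOn.sub (han 3 (.inr rfl)).continuousOn
    obtain ⟨b, hb, hbz⟩ := intermediate_value_Icc hbbar0.le hcont
      (show (0 : ℝ) ∈ Set.Icc _ _ from ⟨by linarith, by linarith⟩)
    refine ⟨b, ⟨hb, sub_eq_zero.1 hbz⟩, ?_⟩
    rintro b' ⟨hb', hbz'⟩
    simp only at hbz
    rcases le_total b b' with h | h
    · have h1 := le_borderCurve_two_sub hm (habs b hb) (habs b' hb') h
      have h2 := borderCurve_three_sub_le hm (habs b hb) (habs b' hb') h
      linarith
    · have h1 := le_borderCurve_two_sub hm (habs b' hb') (habs b hb) h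
      have h2 := borderCurve_three_sub_le hm (habs b' hb') (habs b hb) h
      linarith
  · intro b hb _
    have hnear : ∀ᶠ y in nhdsWithin b (Set.Ioi b), b ≤ y ∧ |y| ≤ 1 / 1000 := by
      filter_upwards [self_mem_nhdsWithin, mem_nhdsWithin_of_mem_nhds
        (Iio_mem_nhds (show b < 1 / 1000 by linarith [hb.2]))] with y h1 h2
      have h1' : b < y := h1
      exact ⟨h1'.le, by rw [abs_of_nonneg (by linarith [hb.1])]; exact le_of_lt h2⟩
    have h2 : 0.3 ≤ deriv (borderCurve m 2) b :=
      le_of_hasDerivAt_of_le_sub (han 2 (.inl rfl) b hb).differentiableAt.hasDerivAt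
        (hnear.mono fun y hy => le_borderCurve_two_sub hm (habs b hb) hy.2 hy.1)
    have h3 : 0.3 ≤ -deriv (borderCurve m 3) b :=
      le_of_hasDerivAt_of_le_sub (han 3 (.inr rfl) b hb).differentiableAt.hasDerivAt.neg
        (hnear.mono fun y hy => by
          have := borderCurve_three_sub_le hm (habs b hb) hy.2 hy.1
          simp only [Pi.neg_apply]
          linarith)
    intro h
    linarith
  · intro a ha σ τ h
    obtain ⟨h1, h2, h3⟩ := hpar ha
    rw [admissibleAt_iff hm (.inr rfl) h1 h2 h3] at h
    exact (admissibleAt_iff hm (.inl rfl) h1 h2 h3).2 (hlt0.le.trans h)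
  · have hP := hmemP 3 (.inr rfl) bbar hbmem
    obtain ⟨h1, h2, h3⟩ := hpar hP
    refine ⟨_, hP, fun σ => ⟨(admissibleAt_iff hm (.inr rfl) h1 h2 h3).2 le_rfl, fun h => ?_⟩⟩
    exact absurd ((admissibleAt_iff hm (.inl rfl) h1 h2 h3).1 h) (not_le.2 hltb)
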